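/- Let $f\in C^\infty(1,\infty)$ be positive, with $f'(x)\le 0$ for all sufficiently large $x$ and $\lim_{x\to\infty} f(x)=\lim_{x\to\infty} f''(x)=0$. Assume moreover that $f$ is regular at the end $x=1$: there are $c>0$ and $C$ such that $f(x)\ge c$ and $|f'(x)|\le C$ for all $x>1$ close enough to $1$ (for instance, $f$ is positive and $C^1$ on $[1,\infty)$). Let $$\Omega=\{(x,y)\in\mathbb R^2:\ x>1,\ |y|<f(x)\}.$$ Let $\sigma\in C^2(1,\infty)$ be non-negative with $\sigma,\sigma',\sigma''$ bounded, and suppose that $$W_\sigma(x)=\frac14\Big(\frac{f'(x)}{f(x)}\Big)^2+\frac12\Big(\frac{f'}{f}\Big)'(x)+\frac{\sigma(x)}{f(x)}\ \longrightarrow\ \infty\qquad (x\to\infty).$$ Consider the quadratic form $$Q_\sigma[u]=\int_\Omega|\nabla u|^2\,dx\,dy+\int_1^\infty\sigma(x)\big(|u(x,f(x))|^2+|u(x,-f(x))|^2\big)\,dx$$ on the restrictions to $\Omega$ of those complex-valued $u\in C^2(\mathbb R^2)$ such that for each $y$ the support of $u(\cdot,y)$ is a compact subset of $(1,\infty)$,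 and such that $u\in L^2(\Omega)$ and $Q_\sigma[u]<\infty$. Then $Q_\sigma$ is closable in $L^2(\Omega)$, the operator $A_\sigma$ in $L^2(\Omega)$ associated with its closure (the Robin Laplacian) is self-adjoint, and the spectrum of $A_\sigma$ is purely discrete: it consists of eigenvalues of finite multiplicity and has no finite accumulation point. The area $|\Omega|$ is not assumed to be finite. -/

import Mathlib

open MeasureTheory Filter Topology
open scoped ContDiff ComplexConjugate

noncomputable section

/-! ### Densely defined operators: spectrum, purely discrete spectrum -/

section Spectrum

variable {H : Type*} [NormedAddCommGroup H] [InnerProductSpace ℂ H]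

/-- `z` belongs to the resolvent set of the unbounded operator `A`: the map `A - z` from the domain
of `A` to `H` has a bounded two-sided inverse `R`, defined on the whole space. -/
def InResolventSet (A : H →ₗ.[ℂ] H) (z : ℂ) : Prop :=
  ∃ R : H →L[ℂ] H,
    (∀ w : H, ∃ h : R w ∈ A.domain, A ⟨R w, h⟩ - z • R w = w) ∧
    (∀ u : A.domain, R (A u - z • (u : H)) = u)

/-- The spectrum of the unbounded operator `A`. -/
def opSpectrum (A : H →ₗ.[ℂ] H) : Set ℂ := {z | ¬ InResolventSet A z}

/-- The eigenspace `ker (A - z)`. -/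
def opEigenspace (A : H →ₗ.[ℂ] H) (z : ℂ) : Submodule ℂ A.domain :=
  LinearMap.ker (A.toFun - z • A.domain.subtype)

/-- Purely discrete spectrum: every point of the spectrum is an eigenvalue of finite multiplicity,
and the spectrum has no accumulation point in `ℂ`. -/
def HasPurelyDiscreteSpectrum (A : H →ₗ.[ℂ] H) : Prop :=
  (∀ z ∈ opSpectrum A, opEigenspace A z ≠ ⊥ ∧ FiniteDimensional ℂ (opEigenspace A z)) ∧
  ∀ z : ℂ, ¬ AccPt z (𝓟 (opSpectrum A))

end Spectrum

/-! ### Nonnegative quadratic forms and the operator associated with their closure -/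

/-- A nonnegative hermitian sesquilinear form `q` (conjugate linear in its first argument) on a
vector space `E` of functions, together with the map `emb` that sends a function of `E` to its class
in the Hilbert space `H`. -/
structure NonnegForm (E H : Type*) [AddCommGroup E] [Module ℂ E]
    [NormedAddCommGroup H] [InnerProductSpace ℂ H] where
  /-- the class in `H` of a function in `E` -/
  emb : E →ₗ[ℂ] H
  /-- the form, i.e. a positive semidefinite inner product -/
  core : PreInnerProductSpace.Core ℂ E

namespace NonnegForm

variable {E H : Type*} [AddCommGroup E] [Module ℂ E]
  [NormedAddCommGroup H] [InnerProductSpace ℂ H] (Q : NonnegForm E H)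

/-- The sesquilinear form `q(u, v)`. -/
def q (u v : E) : ℂ := Q.core.inner u v

/-- `φ` is an approximating sequence for `u`: it converges to `u` in `H` and is Cauchy for the form.
The domain of the closure of the form consists of the `u` that have such a sequence. -/
def Approx (φ : ℕ → E) (u : H) : Prop :=
  Tendsto (fun n => Q.emb (φ n)) atTop (𝓝 u) ∧
  Tendsto (fun p : ℕ × ℕ => (Q.q (φ p.1 - φ p.2) (φ p.1 - φ p.2)).re) atTop (𝓝 0)

/-- The form is closable: it tends to zero along each approximating sequence of `0`. -/
def IsClosable : Prop :=
  ∀ φ : ℕ → E, Q.Approx φ 0 → Tendsto (fun n => (Q.q (φ n) (φ n)).re) atTop (𝓝 0)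

theorem q_add_left (u v w : E) : Q.q (u + v) w = Q.q u w + Q.q v w := Q.core.add_left u v w

theorem q_smul_left (c : ℂ) (u w : E) : Q.q (c • u) w = conj c * Q.q u w :=
  Q.core.smul_left u w c

theorem q_conj (u v : E) : conj (Q.q v u) = Q.q u v := Q.core.conj_inner_symm u v

theorem q_nonneg (u : E) : 0 ≤ (Q.q u u).re := Q.core.re_inner_nonneg u

theorem q_add_right (u v w : E) : Q.q w (u + v) = Q.q w u + Q.q w v := by
  rw [← Q.q_conj, q_add_left, map_add, Q.q_conj, Q.q_conj]

theorem q_smul_right (c : ℂ) (u w : E) : Q.q w (c • u) = c * Q.q w u := by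
  rw [← Q.q_conj, q_smul_left, map_mul, Q.q_conj, Complex.conj_conj]

theorem q_zero_right (w : E) : Q.q w 0 = 0 := by
  simpa using Q.q_smul_right 0 0 w

theorem q_smul_self_re (c : ℂ) (u : E) :
    (Q.q (c • u) (c • u)).re = Complex.normSq c * (Q.q u u).re := by
  rw [q_smul_left, q_smul_right, ← mul_assoc, ← Complex.normSq_eq_conj_mul_self,
    Complex.re_ofReal_mul]

theorem q_add_self_le (u v : E) :
    (Q.q (u + v) (u + v)).re ≤ 2 * (Q.q u u).re + 2 * (Q.q v v).re := by
  have h := Q.q_nonneg (u + (-1 : ℂ) • v)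
  simp only [q_add_left, q_add_right, q_smul_left, q_smul_right, Complex.add_re] at h ⊢
  simp at h
  linarith

variable {Q}

theorem Approx.zero : Q.Approx (fun _ => 0) 0 := by
  refine ⟨by simp, ?_⟩
  simp [q_zero_right]

theorem Approx.add {φ ψ : ℕ → E} {u v : H} (h : Q.Approx φ u) (k : Q.Approx ψ v) :
    Q.Approx (fun n => φ n + ψ n) (u + v) := by
  refine ⟨by simpa using h.1.add k.1, ?_⟩
  refine squeeze_zero (fun p => Q.q_nonneg _) (fun p => ?_)
    (by simpa using (h.2.const_mul 2).add (k.2.const_mul 2))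
  rw [add_sub_add_comm]
  exact Q.q_add_self_le _ _

theorem Approx.smul {φ : ℕ → E} {u : H} (c : ℂ) (h : Q.Approx φ u) :
    Q.Approx (fun n => c • φ n) (c • u) := by
  refine ⟨by simpa using h.1.const_smul c, ?_⟩
  simp only [← smul_sub, q_smul_self_re]
  simpa using h.2.const_mul (Complex.normSq c)

variable (Q)

/-- The graph of the operator associated with the closure `q̄` of the form. A pair `(u, w)` belongs
to it iff `u` is in the domain of `q̄` and `q̄(v, u) = ⟪v, w⟫` for every `v` in the domain of `q̄`,
where `q̄(v, u)` is the limit of `q(ψ n, φ n)` along approximating sequences of `v` and `u`. -/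
def operatorGraph : Submodule ℂ (H × H) where
  carrier := {p | ∃ φ : ℕ → E, Q.Approx φ p.1 ∧ ∀ (v : H) (ψ : ℕ → E), Q.Approx ψ v →
    Tendsto (fun n => Q.q (ψ n) (φ n)) atTop (𝓝 (inner ℂ v p.2))}
  zero_mem' := ⟨fun _ => 0, Approx.zero, fun v ψ _ => by simp [q_zero_right]⟩
  add_mem' := by
    rintro a b ⟨φ, hφ, h⟩ ⟨χ, hχ, k⟩
    refine ⟨fun n => φ n + χ n, hφ.add hχ, fun v ψ hψ => ?_⟩
    simp only [q_add_right, Prod.snd_add, inner_add_right]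
    exact (h v ψ hψ).add (k v ψ hψ)
  smul_mem' := by
    rintro c a ⟨φ, hφ, h⟩
    refine ⟨fun n => c • φ n, hφ.smul c, fun v ψ hψ => ?_⟩
    simp only [q_smul_right, Prod.smul_snd, inner_smul_right]
    exact (h v ψ hψ).const_mul c

/-- The operator associated with the closure of the form. -/
def operator : H →ₗ.[ℂ] H := Q.operatorGraph.toLinearPMap

end NonnegForm

/-! ### The horn-shaped domain and the Robin form -/

/-- The domain `Ω = {(x, y) : x > 1, |y| < f x}`. -/
def hornDomain (f : ℝ → ℝ) : Set (ℝ × ℝ) := {p | 1 < p.1 ∧ |p.2| < f p.1}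

/-- Lebesgue measure on `Ω`. -/
def hornMeasure (f : ℝ → ℝ) : Measure (ℝ × ℝ) := volume.restrict (hornDomain f)

/-- The measure `σ(x) dx` on `(1, ∞)`. -/
def boundaryMeasure (σ : ℝ → ℝ) : Measure ℝ :=
  (volume.restrict (Set.Ioi 1)).withDensity fun x => ENNReal.ofReal (σ x)

/-- The partial derivative `∂u/∂x`. -/
def partialX (u : ℝ × ℝ → ℂ) (p : ℝ × ℝ) : ℂ := fderiv ℝ u p (1, 0)

/-- The partial derivative `∂u/∂y`. -/
def partialY (u : ℝ × ℝ → ℂ) (p : ℝ × ℝ) : ℂ := fderiv ℝ u p (0, 1)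

/-- The functions `u ∈ C²(ℝ²)` such that for each `y` the support of `u(·, y)` is a compact subset
of `(1, ∞)`, and such that `u ∈ L²(Ω)` and the form `Q_σ[u]` is finite. -/
def robinCore (f σ : ℝ → ℝ) : Submodule ℂ (ℝ × ℝ → ℂ) where
  carrier := {u | ContDiff ℝ 2 u ∧
    (∀ y : ℝ, HasCompactSupport (fun x => u (x, y)) ∧ tsupport (fun x => u (x, y)) ⊆ Set.Ioi 1) ∧
    MemLp u 2 (hornMeasure f) ∧
    MemLp (partialX u) 2 (hornMeasure f) ∧ MemLp (partialY u) 2 (hornMeasure f) ∧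
    MemLp (fun x => u (x, f x)) 2 (boundaryMeasure σ) ∧
    MemLp (fun x => u (x, -f x)) 2 (boundaryMeasure σ)}
  zero_mem' := by
    have hx : partialX 0 = 0 := by ext p; simp [partialX]
    have hy : partialY 0 = 0 := by ext p; simp [partialY]
    refine ⟨contDiff_const, fun y => ⟨HasCompactSupport.zero, ?_⟩, MemLp.zero, ?_, ?_,
      MemLp.zero, MemLp.zero⟩
    · simp [tsupport]
    · rw [hx]; exact MemLp.zero
    · rw [hy]; exact MemLp.zero
  add_mem' := by
    rintro u v ⟨u1, u2, u3, u4, u5, u6, u7⟩ ⟨v1, v2, v3, v4, v5, v6, v7⟩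
    have du := u1.differentiable (by norm_num)
    have dv := v1.differentiable (by norm_num)
    have hx : partialX (u + v) = partialX u + partialX v := by
      ext p; simp [partialX, fderiv_add (du p) (dv p)]
    have hy : partialY (u + v) = partialY u + partialY v := by
      ext p; simp [partialY, fderiv_add (du p) (dv p)]
    refine ⟨u1.add v1, fun y => ⟨(u2 y).1.add (v2 y).1, ?_⟩, u3.add v3, ?_, ?_,
      u6.add v6, u7.add v7⟩
    · exact (tsupport_add _ _).trans (Set.union_subset (u2 y).2 (v2 y).2)
    · rw [hx]; exact u4.add v4
    · rw [hy]; exact u5.add v5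
  smul_mem' := by
    rintro c u ⟨u1, u2, u3, u4, u5, u6, u7⟩
    have du := u1.differentiable (by norm_num)
    have hx : partialX (c • u) = c • partialX u := by
      ext p; simp [partialX, fderiv_const_smul (du p) c]
    have hy : partialY (c • u) = c • partialY u := by
      ext p; simp [partialY, fderiv_const_smul (du p) c]
    have hs : ∀ y, tsupport (fun x => (c • u) (x, y)) ⊆ tsupport (fun x => u (x, y)) := fun y =>
      closure_mono (Function.support_const_smul_subset c fun x => u (x, y))
    refine ⟨contDiff_const.smul u1, fun y => ⟨?_, (hs y).trans (u2 y).2⟩, u3.const_smul c, ?_, ?_,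
      u6.const_smul c, u7.const_smul c⟩
    · exact (u2 y).1.of_isClosed_subset (isClosed_tsupport _) (hs y)
    · rw [hx]; exact u4.const_smul c
    · rw [hy]; exact u5.const_smul c

/-- The sesquilinear form of `Q_σ`, so that
`robinForm f σ u u = ∫_Ω |∇u|² dx dy + ∫_1^∞ σ(x) (|u(x, f x)|² + |u(x, -f x)|²) dx`. -/
def robinForm (f σ : ℝ → ℝ) (u v : ℝ × ℝ → ℂ) : ℂ :=
  (∫ p, (conj (partialX u p) * partialX v p + conj (partialY u p) * partialY v p) ∂(hornMeasure f)) +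
  ∫ x, (conj (u (x, f x)) * v (x, f x) + conj (u (x, -f x)) * v (x, -f x)) ∂(boundaryMeasure σ)

theorem integrable_conj_mul {α : Type*} [MeasurableSpace α] {μ : Measure α} {g h : α → ℂ}
    (hg : MemLp g 2 μ) (hh : MemLp h 2 μ) : Integrable (fun x => conj (g x) * h x) μ :=
  hg.star.integrable_mul hh

theorem robinForm_add_left (f σ : ℝ → ℝ) (u v w : robinCore f σ) :
    robinForm f σ ((u + v : robinCore f σ) : ℝ × ℝ → ℂ) w =
      robinForm f σ u w + robinForm f σ v w := by
  obtain ⟨u, u1, u2, u3, u4, u5, u6, u7⟩ := u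
  obtain ⟨v, v1, v2, v3, v4, v5, v6, v7⟩ := v
  obtain ⟨w, w1, w2, w3, w4, w5, w6, w7⟩ := w
  have du := u1.differentiable (by norm_num)
  have dv := v1.differentiable (by norm_num)
  have hx : ∀ p, partialX (u + v) p = partialX u p + partialX v p := fun p => by
    simp [partialX, fderiv_add (du p) (dv p)]
  have hy : ∀ p, partialY (u + v) p = partialY u p + partialY v p := fun p => by
    simp [partialY, fderiv_add (du p) (dv p)]
  simp only [robinForm, Submodule.coe_add, hx, hy, Pi.add_apply, map_add, add_mul]
  rw [add_add_add_comm, ← integral_add, ← integral_add]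
  · congr 1 <;> (congr 1; ext; ring)
  · exact (integrable_conj_mul u6 w6).add (integrable_conj_mul u7 w7)
  · exact (integrable_conj_mul v6 w6).add (integrable_conj_mul v7 w7)
  · exact (integrable_conj_mul u4 w4).add (integrable_conj_mul u5 w5)
  · exact (integrable_conj_mul v4 w4).add (integrable_conj_mul v5 w5)

theorem robinForm_smul_left (f σ : ℝ → ℝ) (u w : robinCore f σ) (c : ℂ) :
    robinForm f σ ((c • u : robinCore f σ) : ℝ × ℝ → ℂ) w = conj c * robinForm f σ u w := by
  obtain ⟨u, u1, u2, u3, u4, u5, u6, u7⟩ := u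
  have du := u1.differentiable (by norm_num)
  have hx : ∀ p, partialX (c • u) p = c * partialX u p := fun p => by
    simp [partialX, fderiv_const_smul (du p) c]
  have hy : ∀ p, partialY (c • u) p = c * partialY u p := fun p => by
    simp [partialY, fderiv_const_smul (du p) c]
  simp only [robinForm, Submodule.coe_smul, hx, hy, Pi.smul_apply, smul_eq_mul, map_mul, mul_add,
    mul_assoc, ← integral_const_mul]

/-- The form `Q_σ` on its core, as a nonnegative form in `L²(Ω)`. -/
def robinNonnegForm (f σ : ℝ → ℝ) : NonnegForm (robinCore f σ) (Lp ℂ 2 (hornMeasure f)) where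
  emb :=
    { toFun := fun u => MemLp.toLp (u : ℝ × ℝ → ℂ) u.2.2.2.1
      map_add' := fun _ _ => rfl
      map_smul' := fun _ _ => rfl }
  core :=
    { inner := fun u v => robinForm f σ u v
      conj_inner_symm := fun u v => by
        simp only [robinForm, map_add, ← integral_conj, map_mul, Complex.conj_conj]
        congr 1 <;> (congr 1; ext; ring)
      re_inner_nonneg := fun u => by
        have key : ∀ z : ℂ, conj z * z = ((Complex.normSq z : ℝ) : ℂ) := fun z =>
          Complex.normSq_eq_conj_mul_self.symm
        simp only [robinForm, key, ← Complex.ofReal_add, integral_complex_ofReal]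
        change 0 ≤ (Complex.ofReal _).re
        rw [Complex.ofReal_re]
        exact add_nonneg
          (integral_nonneg fun _ => add_nonneg (Complex.normSq_nonneg _) (Complex.normSq_nonneg _))
          (integral_nonneg fun _ => add_nonneg (Complex.normSq_nonneg _) (Complex.normSq_nonneg _))
      add_left := robinForm_add_left f σ
      smul_left := fun u v c => robinForm_smul_left f σ u v c }

/-- The Robin Laplacian `A_σ`: the operator in `L²(Ω)` associated with the closure of `Q_σ`. -/
def robinLaplacian (f σ : ℝ → ℝ) : Lp ℂ 2 (hornMeasure f) →ₗ.[ℂ] Lp ℂ 2 (hornMeasure f) :=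
  (robinNonnegForm f σ).operator

/-! ### Assumptions on the profile and on the boundary coefficient -/

/-- `V = (1/4) (f'/f)² + (1/2) (f'/f)'`. -/
def potentialV (f : ℝ → ℝ) (x : ℝ) : ℝ :=
  1 / 4 * (deriv f x / f x) ^ 2 + 1 / 2 * deriv (fun t => deriv f t / f t) x

/-- `W_σ = V + σ / f`. -/
def potentialW (f σ : ℝ → ℝ) (x : ℝ) : ℝ := potentialV f x + σ x / f x

/-- `f ∈ C^∞(1, ∞)` is positive, `f' ≤ 0` near infinity, and `f → 0`, `f'' → 0` at infinity. -/
structure IsCuspProfile (f : ℝ → ℝ) : Prop where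
  smooth : ContDiffOn ℝ ∞ f (Set.Ioi 1)
  pos : ∀ x > 1, 0 < f x
  deriv_nonpos : ∀ᶠ x in atTop, deriv f x ≤ 0
  tendsto_zero : Tendsto f atTop (𝓝 0)
  tendsto_deriv2 : Tendsto (deriv (deriv f)) atTop (𝓝 0)

/-- The boundary of `Ω` is regular at the end `x = 1`: near `1` the profile is bounded away from `0`
and has a bounded derivative. Every `f` that is positive and `C¹` on `[1, ∞)` has this property. -/
def IsRegularAtOne (f : ℝ → ℝ) : Prop :=
  ∃ c C : ℝ, 0 < c ∧ ∀ᶠ x in 𝓝[>] (1 : ℝ), c ≤ f x ∧ |deriv f x| ≤ C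

/-- `σ ∈ C²(1, ∞)` is nonnegative, `σ, σ', σ''` are bounded, and `W_σ → ∞` at infinity. -/
structure IsRobinCoefficient (f σ : ℝ → ℝ) : Prop where
  smooth : ContDiffOn ℝ 2 σ (Set.Ioi 1)
  nonneg : ∀ x > 1, 0 ≤ σ x
  bounded : ∃ C : ℝ, ∀ x > 1, |σ x| ≤ C ∧ |deriv σ x| ≤ C ∧ |deriv (deriv σ) x| ≤ C
  tendsto_W : Tendsto (potentialW f σ) atTop atTop

end

/-! The form is `q(u, v) = ⟪T u, T v⟫`, where `T u` collects the gradient of `u` and its two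
boundary traces. Let `V` be the closure of the graph of `T` in the Hilbert sum, and `J : V → L²(Ω)`
the first projection. The inner product of `V` is `q̄ + ⟪·, ·⟫`, so the weak equation `q̄(v, u) =
⟪v, w⟫` for all `v` says exactly `u = J J* (u + w)`: the operator of the form is `A = R⁻¹ - 1` with
`R = J J*` (`mem_operatorGraph_iff`). `J` is injective because `T` is closable, and `J*` is
injective because test functions are dense. Hence `R` is symmetric and injective and `A` is
self-adjoint. If `J` is compact, the spectral theory of compact operators makes the spectrum of `A`
discrete.

Compactness follows from the estimate `‖u‖² ≤ ε (‖u‖² + Q[u]) + C ∑ |⟪g i, u⟫|²` with finitely many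
`g i`, for every `ε > 0`. The horn is cut at a large `x = R`.

For `x < R` the coordinates `(x, t) = (x, y / f x)` turn the horn into a rectangle, with distortion
bounded thanks to the regularity at `x = 1`. A Poincaré inequality on small cells gives the
estimate, the `g i` representing cell integrals (`exists_integral_body_le`). No boundary condition
is used there.

For `x > R` let `N(x)` and `D(x)` be the integrals of `|u|²` and `|∇u|²` over the slice at `x`, and
`B(x)` the boundary density. Put `a = f'/(2f)` and `b = σ + a f'`. Expanding `|∂ₓu + a u|² + |∂ᵧu +
b t u|² ≥ 0` over a slice yields `(a N)' ≥ (W_σ - b²) N - D - B`. Since `f'² ≤ 2f` far out and `σ`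
is bounded, `b²` is bounded. Since `a ≤ 0` far out, integration bounds `M ∫_{x>R} N` by `Q[u] + K
‖u‖²`, with `K` independent of `M` (`exists_integral_tail_le`). As `W_σ → ∞`, `M` can be taken
arbitrarily large.

Closability of the gradient is integration by parts against test functions. The traces are
controlled on compact pieces of the boundary by `u` and `∂ᵧu`, so they tend to zero there once both
of these do. -/

/-! ### Operators with a compact symmetric resolvent at `-1` -/

section Resolvent

variable {H : Type*} [NormedAddCommGroup H] [InnerProductSpace ℂ H] 

/-- A densely defined operator whose shift by one has a bounded self-adjoint inverse `R` is
self-adjoint. -/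
theorem isSelfAdjoint_of_mem_graph_iff [CompleteSpace H] {A : H →ₗ.[ℂ] H} {R : H →L[ℂ] H}
    (hR : (R : H →ₗ[ℂ] H).IsSymmetric) (hinj : ∀ w, R w = 0 → w = 0)
    (hA : ∀ u w, (u, w) ∈ A.graph ↔ u = R (u + w)) : IsSelfAdjoint A := by
  have hR' : ∀ x y, inner ℂ (R x) y = inner ℂ x (R y) := hR
  have hmem : ∀ z, (R z, z - R z) ∈ A.graph := fun z => by rw [hA]; simp
  have hdense : Dense (A.domain : Set H) := by
    rw [Submodule.dense_iff_topologicalClosure_eq_top, Submodule.topologicalClosure_eq_top_iff,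
      Submodule.eq_bot_iff]
    intro w hw
    refine hinj w ?_
    rw [← inner_self_eq_zero (𝕜 := ℂ)]
    -- For `w` orthogonal to the domain, `0 = ⟪R (R w), w⟫ = ‖R w‖²`.
    have : R (R w) ∈ A.domain := LinearPMap.mem_domain_of_mem_graph (hmem (R w))
    have h := (Submodule.mem_orthogonal _ _).1 hw _ this
    rwa [hR'] at h
  rw [LinearPMap.isSelfAdjoint_def]
  apply LinearPMap.eq_of_eq_graph
  rw [LinearPMap.adjoint_graph_eq_graph_adjoint hdense]
  ext ⟨v, w⟩
  rw [Submodule.mem_adjoint_iff, hA]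
  constructor
  · intro h
    -- Testing the adjoint relation on the pairs `(R z, z - R z)`, which exhaust the graph of `A`.
    have key : ∀ z, inner ℂ z (v - R (v + w)) = 0 := fun z => by
      have := h _ _ (hmem z)
      simp only [inner_sub_left, inner_sub_right, map_add, inner_add_right] at this ⊢
      rw [hR', hR'] at this
      linear_combination this
    exact sub_eq_zero.1 (inner_self_eq_zero (𝕜 := ℂ).1 (key _))
  · intro h a b hab
    rw [hA] at hab
    have h1 : inner ℂ (a + b) v = inner ℂ a (v + w) := by
      conv_lhs => rw [h, ← hR', ← hab]
    simp only [inner_add_left, inner_add_right] at h1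
    linear_combination h1

theorem mem_domain_of_mem_graph_iff {A : H →ₗ.[ℂ] H} {R : H →L[ℂ] H}
    (hA : ∀ u w, (u, w) ∈ A.graph ↔ u = R (u + w)) (z : H) :
    ∃ h : R z ∈ A.domain, A ⟨R z, h⟩ = z - R z := by
  have hm : (R z, z - R z) ∈ A.graph := by rw [hA]; simp
  exact ⟨LinearPMap.mem_domain_of_mem_graph hm, (LinearPMap.mem_graph_snd_inj A
    (A.mem_graph ⟨R z, LinearPMap.mem_domain_of_mem_graph hm⟩) hm rfl)⟩

theorem apply_add_of_mem_graph_iff {A : H →ₗ.[ℂ] H} {R : H →L[ℂ] H}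
    (hA : ∀ u w, (u, w) ∈ A.graph ↔ u = R (u + w)) (u : A.domain) :
    R ((u : H) + A u) = u :=
  ((hA _ _).1 (A.mem_graph u)).symm

/-- Points off the spectrum of `A` from points off the spectrum of `R = (A + 1)⁻¹`. -/
theorem inResolventSet_of_isUnit {A : H →ₗ.[ℂ] H} {R : H →L[ℂ] H}
    (hA : ∀ u w, (u, w) ∈ A.graph ↔ u = R (u + w)) {z : ℂ}
    (hz : IsUnit (1 - (1 + z) • R)) : InResolventSet A z := by
  obtain ⟨S, hS⟩ := hz
  have h1 : ∀ x, (↑S⁻¹ : H →L[ℂ] H) x - (1 + z) • R ((↑S⁻¹ : H →L[ℂ] H) x) = x := fun x => by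
    have := congrArg (fun T : H →L[ℂ] H => T x) (S.mul_inv)
    simpa [hS] using this
  have h2 : ∀ x, (↑S⁻¹ : H →L[ℂ] H) (x - (1 + z) • R x) = x := fun x => by
    have := congrArg (fun T : H →L[ℂ] H => T x) (S.inv_mul)
    simpa [hS] using this
  have hcomm : ∀ x, R ((↑S⁻¹ : H →L[ℂ] H) x) = (↑S⁻¹ : H →L[ℂ] H) (R x) := fun x => by
    conv_rhs => rw [← h1 x]
    rw [map_sub, map_smul, h2]
  -- With `S = 1 - (1 + z) R`, the splitting `A - z = (A + 1) - (1 + z)` gives `(A - z)⁻¹ = R S⁻¹`.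
  refine ⟨R ∘L ↑S⁻¹, fun w => ?_, fun u => ?_⟩
  · obtain ⟨h, e⟩ := mem_domain_of_mem_graph_iff hA ((↑S⁻¹ : H →L[ℂ] H) w)
    refine ⟨h, ?_⟩
    have := h1 w
    simp only [ContinuousLinearMap.comp_apply]
    rw [e]
    nth_rewrite 4 [← this]
    module
  · have h := apply_add_of_mem_graph_iff hA u
    simp only [ContinuousLinearMap.comp_apply]
    rw [hcomm]
    have : R (A u - z • (u : H)) = u - (1 + z) • R u := by
      have e : A u - z • (u : H) = (u + A u) - (1 + z) • (u : H) := by module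
      rw [e, map_sub, h, map_smul]
    rw [this, h2]

/-- Fredholm alternative: `1 - (1 + z) R = (1 + z) ((1 + z)⁻¹ - R)` is not invertible, so the
nonzero number `(1 + z)⁻¹` is in the spectrum of the compact operator `R`. The point `z = -1` drops
out because there the left side is `1`. -/
theorem hasEigenvalue_of_mem_opSpectrum [CompleteSpace H] {A : H →ₗ.[ℂ] H} {R : H →L[ℂ] H}
    (hc : IsCompactOperator R)
    (hA : ∀ u w, (u, w) ∈ A.graph ↔ u = R (u + w)) {z : ℂ} (hz : z ∈ opSpectrum A) :
    1 + z ≠ 0 ∧ Module.End.HasEigenvalue (R : Module.End ℂ H) (1 + z)⁻¹ := by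
  have hu : ¬ IsUnit (1 - (1 + z) • R) := fun h => hz (inResolventSet_of_isUnit hA h)
  have h0 : 1 + z ≠ 0 := by
    intro h
    rw [h] at hu
    simp at hu
  refine ⟨h0, (hc.hasEigenvalue_iff_mem_spectrum (inv_ne_zero h0)).2 fun hmem => hu ?_⟩
  have h1 : (1 : H →L[ℂ] H) - (1 + z) • R =
      algebraMap ℂ (H →L[ℂ] H) (1 + z) * (algebraMap ℂ (H →L[ℂ] H) (1 + z)⁻¹ - R) := by
    rw [mul_sub, ← map_mul, mul_inv_cancel₀ h0, map_one, Algebra.algebraMap_eq_smul_one,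
      smul_mul_assoc, one_mul]
  rw [h1]
  exact ((isUnit_iff_ne_zero.2 h0).map _).mul hmem

/-- An operator with compact self-adjoint resolvent at `-1` has purely discrete spectrum. -/
theorem hasPurelyDiscreteSpectrum_of_isCompactOperator [CompleteSpace H] {A : H →ₗ.[ℂ] H} {R : H →L[ℂ] H}
    (hR : (R : H →ₗ[ℂ] H).IsSymmetric) (hc : IsCompactOperator R)
    (hA : ∀ u w, (u, w) ∈ A.graph ↔ u = R (u + w)) : HasPurelyDiscreteSpectrum A := by
  have eig : ∀ z : ℂ, ∀ w : H, 1 + z ≠ 0 → R w = (1 + z)⁻¹ • w →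
      ∃ h : w ∈ A.domain, A ⟨w, h⟩ = z • w := by
    intro z w h0 hw
    have hw' : R ((1 + z) • w) = w := by rw [map_smul, hw, smul_inv_smul₀ h0]
    have hm : (w, z • w) ∈ A.graph := by
      rw [hA]
      have : w + z • w = (1 + z) • w := by module
      rw [this, hw']
    exact ⟨LinearPMap.mem_domain_of_mem_graph hm, LinearPMap.mem_graph_snd_inj A
      (A.mem_graph ⟨w, LinearPMap.mem_domain_of_mem_graph hm⟩) hm rfl⟩
  refine ⟨fun z hz => ?_, fun z hz => ?_⟩
  · obtain ⟨h0, he⟩ := hasEigenvalue_of_mem_opSpectrum hc hA hz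
    constructor
    · obtain ⟨w, hw⟩ := he.exists_hasEigenvector
      obtain ⟨h, e⟩ := eig z w h0 hw.apply_eq_smul
      rw [Submodule.ne_bot_iff]
      refine ⟨⟨w, h⟩, ?_, fun h => hw.2 (congrArg Subtype.val h)⟩
      simp only [opEigenspace, LinearMap.mem_ker, LinearMap.sub_apply, LinearMap.smul_apply,
        Submodule.subtype_apply]
      rw [sub_eq_zero]
      exact e
    · have := ContinuousLinearMap.finite_dimensional_eigenspace hc (1 + z)⁻¹ (inv_ne_zero h0)
      have hmap : ∀ u ∈ opEigenspace A z,
          (u : H) ∈ Module.End.eigenspace (R : Module.End ℂ H) (1 + z)⁻¹ := by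
        intro u hu
        simp only [opEigenspace, LinearMap.mem_ker, LinearMap.sub_apply, LinearMap.smul_apply,
          Submodule.subtype_apply, sub_eq_zero] at hu
        rw [Module.End.mem_eigenspace_iff]
        have h := apply_add_of_mem_graph_iff hA u
        have hu' : A u = z • (u : H) := hu
        rw [hu'] at h
        have e : (u : H) + z • (u : H) = (1 + z) • (u : H) := by module
        rw [e, map_smul] at h
        change R u = _
        rw [eq_comm, inv_smul_eq_iff₀ h0]
        exact h.symm
      let L : opEigenspace A z →ₗ[ℂ] Module.End.eigenspace (R : Module.End ℂ H) (1 + z)⁻¹ :=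
        (A.domain.subtype ∘ₗ (opEigenspace A z).subtype).codRestrict _ fun u => hmap u u.2
      refine FiniteDimensional.of_injective L fun a b hab => ?_
      have := congrArg Subtype.val hab
      exact Subtype.ext (Subtype.ext this)
  · -- infinitely many eigenvalues near `z` give an orthonormal sequence with separated images
    have hinf : (opSpectrum A ∩ Metric.closedBall z 1).Infinite := by
      intro hfin
      have h1 := accPt_iff_frequently.1 hz
      have h2 : ∀ᶠ y in 𝓝 z, y ∈ Metric.closedBall z 1 := Metric.closedBall_mem_nhds z one_pos
      -- A finite set without `z` is closed and misses a neighbourhood of `z`.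
      have h3 : ∀ᶠ y in 𝓝 z, y ∉ (opSpectrum A ∩ Metric.closedBall z 1) \ {z} :=
        (hfin.subset Set.sdiff_subset).isClosed.isOpen_compl.mem_nhds (by simp)
      obtain ⟨y, ⟨hy1, hy2⟩, hy3, hy4⟩ := (h1.and_eventually (h2.and h3)).exists
      exact hy4 ⟨⟨hy2, hy3⟩, hy1⟩
    let l : ℕ → ℂ := fun n => hinf.natEmbedding _ n
    have hl : ∀ n, l n ∈ opSpectrum A ∩ Metric.closedBall z 1 := fun n =>
      (hinf.natEmbedding _ n).2
    have hlinj : Function.Injective l := Subtype.val_injective.comp (hinf.natEmbedding _).injective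
    have he : ∀ n, ∃ e : H, ‖e‖ = 1 ∧ R e = (1 + l n)⁻¹ • e := by
      intro n
      obtain ⟨h0, h⟩ := hasEigenvalue_of_mem_opSpectrum hc hA (hl n).1
      obtain ⟨w, hw⟩ := h.exists_hasEigenvector
      have hw' : R w = (1 + l n)⁻¹ • w := hw.apply_eq_smul
      refine ⟨(‖w‖⁻¹ : ℂ) • w, ?_, ?_⟩
      · rw [norm_smul, norm_inv, Complex.norm_real, norm_norm, inv_mul_cancel₀ (norm_ne_zero_iff.2 hw.2)]
      · rw [map_smul, hw', smul_comm]
    choose e he1 he2 using he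
    have h0 : ∀ n, 1 + l n ≠ 0 := fun n => (hasEigenvalue_of_mem_opSpectrum hc hA (hl n).1).1
    have horth : ∀ m n, m ≠ n → inner ℂ (R (e m)) (R (e n)) = 0 := by
      intro m n hmn
      refine hR.orthogonalFamily_eigenspaces (i := (1 + l m)⁻¹) (j := (1 + l n)⁻¹) ?_
        ⟨R (e m), ?_⟩ ⟨R (e n), ?_⟩
      · exact fun h => hmn (hlinj (add_left_cancel (inv_injective h)))
      · rw [Module.End.mem_eigenspace_iff]
        change R (R (e m)) = _
        rw [he2 m, map_smul, he2 m]
      · rw [Module.End.mem_eigenspace_iff]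
        change R (R (e n)) = _
        rw [he2 n, map_smul, he2 n]
    have hlow : ∀ n, (‖z‖ + 2)⁻¹ ≤ ‖R (e n)‖ := by
      intro n
      rw [he2, norm_smul, he1, mul_one, norm_inv]
      refine inv_anti₀ (norm_pos_iff.2 (h0 n)) ?_
      have h1 : ‖l n - z‖ ≤ 1 := by simpa [dist_eq_norm] using (hl n).2
      calc ‖1 + l n‖ = ‖1 + (l n - z) + z‖ := by ring_nf
        _ ≤ ‖(1 : ℂ)‖ + ‖l n - z‖ + ‖z‖ := norm_add₃_le
        _ ≤ ‖z‖ + 2 := by rw [norm_one]; linarith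
    obtain ⟨K, hK, hK'⟩ := hc.image_closedBall_subset_compact (𝕜₁ := ℂ) (f := (R : H →ₗ[ℂ] H)) 1
    obtain ⟨y, -, ψ, hψ, hψy⟩ := hK.tendsto_subseq
      (x := fun n => R (e n)) (fun n => hK' ⟨e n, by simp [he1], rfl⟩)
    have hcau := hψy.cauchySeq
    rw [Metric.cauchySeq_iff'] at hcau
    obtain ⟨N, hN⟩ := hcau (‖z‖ + 2)⁻¹ (by positivity)
    have h1 := hN (N + 1) (Nat.le_succ N)
    simp only [Function.comp_apply, dist_eq_norm] at h1
    -- By orthogonality `‖R e_m - R e_n‖ ≥ ‖R e_m‖ ≥ (‖z‖ + 2)⁻¹`, so no subsequence of the images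
    -- is Cauchy.
    have h3 := @norm_sub_sq ℂ H _ _ _ (R (e (ψ (N + 1)))) (R (e (ψ N)))
    rw [horth _ _ (hψ.injective.ne (Nat.succ_ne_self N))] at h3
    have h4 := hlow (ψ (N + 1))
    have h5 : ‖R (e (ψ (N + 1)))‖ ≤ ‖R (e (ψ (N + 1))) - R (e (ψ N))‖ := by
      refine (sq_le_sq₀ (norm_nonneg _) (norm_nonneg _)).1 ?_
      rw [h3]
      simp
    linarith

end Resolvent

/-! ### Compactness from smallness modulo finitely many functionals -/

section Compactness

variable {V H : Type*} [NormedAddCommGroup V] [InnerProductSpace ℂ V] [CompleteSpace V]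
  [NormedAddCommGroup H] [InnerProductSpace ℂ H] [CompleteSpace H]

/-- An operator which is small in norm modulo finitely many functionals is compact. -/
theorem isCompactOperator_of_forall_norm_sq_le {J : V →L[ℂ] H}
    (h : ∀ ε > 0, ∃ (ι : Type) (s : Finset ι) (g : ι → H) (C : ℝ), ∀ x, ‖J x‖ ^ 2 ≤
      ε * ‖x‖ ^ 2 + C * ∑ i ∈ s, ‖inner ℂ (g i) (J x)‖ ^ 2) : IsCompactOperator J := by
  have key : ∀ ε > 0, ∃ F : V →L[ℂ] H, IsCompactOperator F ∧ ‖J - F‖ ≤ ε := by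
    intro ε hε
    obtain ⟨ι, s, g, C, hs⟩ := h (ε ^ 2) (by positivity)
    classical
    -- On `Wᗮ` all functionals `⟪g i, J ·⟫` vanish, so `J` has norm at most `ε` there. Composing `J`
    -- with the projection onto `W` gives a finite-rank operator within `ε` of `J`.
    let W : Submodule ℂ V := Submodule.span ℂ ((s.image fun i => J.adjoint (g i) : Finset V) : Set V)
    have : FiniteDimensional ℂ W := FiniteDimensional.span_finset ℂ _
    refine ⟨J ∘L W.subtypeL ∘L W.orthogonalProjectionOnto, ?_, ?_⟩
    · exact ((isCompactOperator_of_locallyCompactSpace_dom (W.orthogonalProjectionOnto)).clm_comp (J ∘L W.subtypeL))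
    · refine ContinuousLinearMap.opNorm_le_bound _ hε.le fun x => ?_
      set y := x - W.orthogonalProjectionOnto x with hy
      have e : (J - J ∘L W.subtypeL ∘L W.orthogonalProjectionOnto) x = J y := by simp [hy]
      rw [e]
      have hyW : y ∈ Wᗮ := W.sub_starProjection_mem_orthogonal x
      have h0 : ∀ i ∈ s, inner ℂ (g i) (J y) = 0 := by
        intro i hi
        rw [← ContinuousLinearMap.adjoint_inner_left]
        refine (Submodule.mem_orthogonal _ _).1 hyW _ (Submodule.subset_span ?_)
        simpa using ⟨i, hi, rfl⟩
      have h1 := hs y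
      rw [Finset.sum_eq_zero (fun i hi => by rw [h0 i hi]; simp), mul_zero, add_zero,
        ← mul_pow] at h1
      have h2 : ‖J y‖ ≤ ε * ‖y‖ := (sq_le_sq₀ (norm_nonneg _) (by positivity)).1 h1
      have h3 : ‖y‖ ≤ ‖x‖ := by
        have h4 := W.norm_sq_eq_add_norm_sq_starProjection x
        rw [Submodule.starProjection_orthogonal_val] at h4
        refine (sq_le_sq₀ (norm_nonneg _) (norm_nonneg _)).1 ?_
        have h5 : ‖y‖ ^ 2 = ‖x - W.starProjection x‖ ^ 2 := rfl
        nlinarith [sq_nonneg ‖W.starProjection x‖]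
      exact h2.trans (by gcongr)
  choose F hF1 hF2 using fun n : ℕ => key (1 / ((n : ℝ) + 1)) (by positivity)
  refine isCompactOperator_of_tendsto (l := atTop) (F := F) ?_ (Eventually.of_forall hF1)
  rw [tendsto_iff_norm_sub_tendsto_zero]
  refine squeeze_zero (fun n => norm_nonneg _) (fun n => ?_) tendsto_one_div_add_atTop_nhds_zero_nat
  rw [norm_sub_rev]
  exact hF2 n

end Compactness

/-! ### The operator of a form `⟪T u, T v⟫` -/

namespace NonnegForm

variable {E H K : Type*} [AddCommGroup E] [Module ℂ E]
  [NormedAddCommGroup H] [InnerProductSpace ℂ H]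
  [NormedAddCommGroup K] [InnerProductSpace ℂ K]

/-- The graph of `T` over the embedding of `E` into `H`. -/
noncomputable def graphMap (Q : NonnegForm E H) (T : E →ₗ[ℂ] K) : E →ₗ[ℂ] WithLp 2 (H × K) :=
  (WithLp.linearEquiv 2 ℂ (H × K)).symm.toLinearMap ∘ₗ Q.emb.prod T

/-- The closure of the graph of `T` over the embedding of `E` into `H`. -/
noncomputable def closedGraph (Q : NonnegForm E H) (T : E →ₗ[ℂ] K) :
    Submodule ℂ (WithLp 2 (H × K)) :=
  (LinearMap.range (Q.graphMap T)).topologicalClosure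

instance [CompleteSpace H] [CompleteSpace K] (Q : NonnegForm E H) (T : E →ₗ[ℂ] K) :
    CompleteSpace (Q.closedGraph T) :=
  (Submodule.isClosed_topologicalClosure _).completeSpace_coe

/-- The first projection of the closed graph. -/
noncomputable def graphFst (Q : NonnegForm E H) (T : E →ₗ[ℂ] K) : Q.closedGraph T →L[ℂ] H :=
  WithLp.fstL 2 ℂ H K ∘L (Q.closedGraph T).subtypeL

theorem mem_closedGraph_iff {Q : NonnegForm E H} {T : E →ₗ[ℂ] K} {x : WithLp 2 (H × K)} :
    x ∈ Q.closedGraph T ↔ ∃ φ : ℕ → E, Tendsto (fun n => Q.emb (φ n)) atTop (𝓝 x.fst) ∧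
      Tendsto (fun n => T (φ n)) atTop (𝓝 x.snd) := by
  have hlim : ∀ φ : ℕ → E, Tendsto (fun n => Q.graphMap T (φ n)) atTop (𝓝 x) ↔
      Tendsto (fun n => Q.emb (φ n)) atTop (𝓝 x.fst) ∧
      Tendsto (fun n => T (φ n)) atTop (𝓝 x.snd) := by
    intro φ
    rw [(WithLp.homeomorphProd 2 H K).isEmbedding.tendsto_nhds_iff, nhds_prod_eq,
      Filter.tendsto_prod_iff']
    rfl
  rw [closedGraph, ← SetLike.mem_coe, Submodule.topologicalClosure_coe, mem_closure_iff_seq_limit]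
  constructor
  · rintro ⟨y, hy, hyx⟩
    choose φ hφ using hy
    obtain rfl : (fun n => Q.graphMap T (φ n)) = y := funext hφ
    exact ⟨φ, (hlim φ).1 hyx⟩
  · rintro ⟨φ, h⟩
    exact ⟨_, fun n => ⟨φ n, rfl⟩, (hlim φ).2 h⟩

/-- Since `q(w, w) = ‖T w‖²`, being Cauchy for the form means that `T φ` is Cauchy, hence convergent
in the complete space `K`. Together with `mem_closedGraph_iff` this identifies the domain of the
closed form with the first components of the closed graph. -/
theorem approx_iff [CompleteSpace K] {Q : NonnegForm E H} {T : E →ₗ[ℂ] K}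
    (hT : ∀ u v, Q.q u v = inner ℂ (T u) (T v)) {φ : ℕ → E} {u : H} :
    Q.Approx φ u ↔ Tendsto (fun n => Q.emb (φ n)) atTop (𝓝 u) ∧
      ∃ k, Tendsto (fun n => T (φ n)) atTop (𝓝 k) := by
  have hq : ∀ w, (Q.q w w).re = ‖T w‖ ^ 2 := fun w => by
    rw [hT, inner_self_eq_norm_sq_to_K]
    norm_cast
  refine and_congr_right fun _ => ?_
  simp only [hq, map_sub]
  rw [← cauchy_map_iff_exists_tendsto, ← CauchySeq, cauchySeq_iff_tendsto_dist_atTop_0]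
  simp only [dist_eq_norm]
  constructor
  · intro h
    simpa [Real.sqrt_sq] using h.sqrt
  · intro h
    simpa using h.pow 2

/-- The right side is `⟪·, ·⟫ + q̄`; the extra `⟪·, ·⟫` is the source of the shift by one in `R = (A
+ 1)⁻¹`. -/
theorem inner_closedGraph (Q : NonnegForm E H) (T : E →ₗ[ℂ] K) (x y : Q.closedGraph T) :
    inner ℂ x y = inner ℂ (x : WithLp 2 (H × K)).fst (y : WithLp 2 (H × K)).fst +
      inner ℂ (x : WithLp 2 (H × K)).snd (y : WithLp 2 (H × K)).snd := by
  rw [Submodule.coe_inner, WithLp.prod_inner_apply]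
  rfl

/-- The graph of the operator of a closable form in terms of `R = J J*`. -/
theorem mem_operatorGraph_iff [CompleteSpace H] [CompleteSpace K] {Q : NonnegForm E H}
    {T : E →ₗ[ℂ] K} (hT : ∀ u v, Q.q u v = inner ℂ (T u) (T v)) (u w : H) :
    (u, w) ∈ Q.operatorGraph ↔
      u = (Q.graphFst T ∘L (Q.graphFst T).adjoint) (u + w) := by
  constructor
  · rintro ⟨φ, hφ, h⟩
    obtain ⟨h1, k, h2⟩ := (approx_iff hT).1 hφ
    -- The lift of `u` to the closed graph. Against every `y` the weak equation reads `⟪y, x⟫ = ⟪J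
    -- y, u + w⟫`, which is the definition of `J* (u + w)`.
    let x : Q.closedGraph T := ⟨WithLp.toLp 2 (u, k), mem_closedGraph_iff.2 ⟨φ, h1, h2⟩⟩
    have hx : x = (Q.graphFst T).adjoint (u + w) := by
      refine ext_inner_left ℂ fun y => ?_
      rw [ContinuousLinearMap.adjoint_inner_right, inner_closedGraph]
      obtain ⟨ψ, h3, h4⟩ := mem_closedGraph_iff.1 y.2
      have h5 := h _ ψ ((approx_iff hT).2 ⟨h3, _, h4⟩)
      simp only [hT] at h5
      have h6 := tendsto_nhds_unique h5 (h4.inner h2)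
      change inner ℂ _ w = _ at h6
      change inner ℂ _ u + inner ℂ _ k = inner ℂ (y : WithLp 2 (H × K)).fst (u + w)
      rw [← h6, inner_add_right]
    rw [ContinuousLinearMap.comp_apply, ← hx]
    rfl
  · intro h
    set x := (Q.graphFst T).adjoint (u + w) with hx
    have hxu : (x : WithLp 2 (H × K)).fst = u := h.symm
    obtain ⟨φ, h1, h2⟩ := mem_closedGraph_iff.1 x.2
    rw [hxu] at h1
    refine ⟨φ, (approx_iff hT).2 ⟨h1, _, h2⟩, fun v ψ hψ => ?_⟩
    obtain ⟨h3, k, h4⟩ := (approx_iff hT).1 hψ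
    let y : Q.closedGraph T := ⟨WithLp.toLp 2 (v, k), mem_closedGraph_iff.2 ⟨ψ, h3, h4⟩⟩
    have h5 := inner_closedGraph Q T y x
    rw [hx, ContinuousLinearMap.adjoint_inner_right, ← hx, hxu] at h5
    change inner ℂ v (u + w) = inner ℂ v u + inner ℂ k _ at h5
    rw [inner_add_right, add_right_inj] at h5
    simp only [hT]
    rw [h5]
    exact h4.inner h2

/-- A densely defined form `q(u, v) = ⟪T u, T v⟫` with closable `T` and compactly embedded domain
is closable, and its operator is self-adjoint with purely discrete spectrum. -/
theorem isSelfAdjoint_and_hasPurelyDiscreteSpectrum [CompleteSpace H] [CompleteSpace K]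
    {Q : NonnegForm E H} {T : E →ₗ[ℂ] K} (hT : ∀ u v, Q.q u v = inner ℂ (T u) (T v))
    (hcl : ∀ (φ : ℕ → E) (k : K), Tendsto (fun n => Q.emb (φ n)) atTop (𝓝 0) →
      Tendsto (fun n => T (φ n)) atTop (𝓝 k) → k = 0)
    (hd : DenseRange Q.emb)
    (hcpt : ∀ ε > 0, ∃ (ι : Type) (s : Finset ι) (g : ι → H) (C : ℝ), ∀ u, ‖Q.emb u‖ ^ 2 ≤
      ε * (‖Q.emb u‖ ^ 2 + ‖T u‖ ^ 2) + C * ∑ i ∈ s, ‖inner ℂ (g i) (Q.emb u)‖ ^ 2) :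
    Q.IsClosable ∧ IsSelfAdjoint Q.operator ∧ HasPurelyDiscreteSpectrum Q.operator := by
  set J := Q.graphFst T with hJ
  -- A closed-graph element over `0` has second component `0`: this is closability of `T`.
  have hJinj : ∀ x, J x = 0 → x = 0 := by
    intro x hx
    obtain ⟨φ, h1, h2⟩ := mem_closedGraph_iff.1 x.2
    have hx' : (x : WithLp 2 (H × K)).fst = 0 := hx
    rw [hx'] at h1
    have h3 := hcl φ _ h1 h2
    rw [← inner_self_eq_zero (𝕜 := ℂ), inner_closedGraph, hx', h3]
    simp
  have hJdense : ∀ w, J.adjoint w = 0 → w = 0 := by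
    intro w hw
    refine hd.eq_zero_of_inner_left ℂ fun u => ?_
    let x : Q.closedGraph T := ⟨WithLp.toLp 2 (Q.emb u, T u),
      mem_closedGraph_iff.2 ⟨fun _ => u, tendsto_const_nhds, tendsto_const_nhds⟩⟩
    have h : inner ℂ (J.adjoint w) x = inner ℂ w (Q.emb u) :=
      ContinuousLinearMap.adjoint_inner_left J x w
    rw [← h, hw, inner_zero_left]
  have hsymm : ((J ∘L J.adjoint : H →L[ℂ] H) : H →ₗ[ℂ] H).IsSymmetric := by
    intro x y
    change inner ℂ (J (J.adjoint x)) y = inner ℂ x (J (J.adjoint y))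
    rw [← ContinuousLinearMap.adjoint_inner_right J, ← ContinuousLinearMap.adjoint_inner_left J]
  have hRinj : ∀ w, (J ∘L J.adjoint) w = 0 → w = 0 := fun w hw => hJdense w (hJinj _ hw)
  -- `toLinearPMap` has the prescribed graph only if that relation is single-valued; a pair `(0, w)`
  -- satisfies `R w = 0`, so `w = 0`.
  have hgraph : Q.operator.graph = Q.operatorGraph := by
    refine Submodule.toLinearPMap_graph_eq _ ?_
    rintro ⟨u, w⟩ hx rfl
    have := (mem_operatorGraph_iff hT _ _).1 hx
    rw [zero_add] at this
    exact hRinj w this.symm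
  have hA : ∀ u w, (u, w) ∈ Q.operator.graph ↔ u = (J ∘L J.adjoint) (u + w) := by
    intro u w
    rw [hgraph, mem_operatorGraph_iff hT]
  have hJc : IsCompactOperator J := by
    refine isCompactOperator_of_forall_norm_sq_le fun ε hε => ?_
    obtain ⟨ι, s, g, C, h⟩ := hcpt ε hε
    refine ⟨ι, s, g, C, fun x => ?_⟩
    -- Both sides of the estimate are continuous in the graph norm, so it passes from the core to
    -- its closure.
    obtain ⟨φ, h1, h2⟩ := mem_closedGraph_iff.1 x.2
    have hn : ‖x‖ ^ 2 = ‖(x : WithLp 2 (H × K)).fst‖ ^ 2 + ‖(x : WithLp 2 (H × K)).snd‖ ^ 2 :=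
      WithLp.prod_norm_sq_eq_of_L2 (x : WithLp 2 (H × K))
    rw [hn]
    refine le_of_tendsto_of_tendsto' (h1.norm.pow 2)
      ((((h1.norm.pow 2).add (h2.norm.pow 2)).const_mul ε).add
        ((tendsto_finsetSum s fun i _ => ((tendsto_const_nhds.inner h1).norm.pow 2)).const_mul C))
      fun n => h (φ n)
  refine ⟨fun φ hφ => ?_, isSelfAdjoint_of_mem_graph_iff hsymm hRinj hA,
    hasPurelyDiscreteSpectrum_of_isCompactOperator hsymm (hJc.comp_clm _) hA⟩
  obtain ⟨h1, k, h2⟩ := (approx_iff hT).1 hφ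
  rw [hcl φ k h1 h2] at h2
  simp only [hT]
  have h3 := (Complex.continuous_re.tendsto _).comp (h2.inner (𝕜 := ℂ) h2)
  rwa [inner_zero_left, Complex.zero_re] at h3

end NonnegForm

/-! ### Integrals depending on a parameter -/

section ParametricIntegrals

variable {G : Type*} [NormedAddCommGroup G]

theorem continuousOn_intervalIntegral_param [NormedSpace ℝ G] {F : ℝ → ℝ → G} {U : Set ℝ}
    (hF : ContinuousOn (Function.uncurry F) (U ×ˢ Set.univ)) (a b : ℝ) :
    ContinuousOn (fun x => ∫ t in a..b, F x t) U := by
  rw [continuousOn_iff_continuous_domRestrict]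
  refine intervalIntegral.continuous_parametric_intervalIntegral_of_continuous'
    (f := fun (x : U) t => F x t) ?_ a b
  exact hF.comp_continuous
    (f := fun p : U × ℝ => ((p.1 : ℝ), p.2)) (by fun_prop) (fun p => ⟨p.1.2, trivial⟩)

theorem continuous_of_continuousOn_prod_univ {F : ℝ → ℝ → G} {U : Set ℝ}
    (hF : ContinuousOn (Function.uncurry F) (U ×ˢ Set.univ)) {x : ℝ} (hx : x ∈ U) :
    Continuous (F x) :=
  hF.comp_continuous (f := fun t => (x, t)) (by fun_prop) (fun _ => ⟨hx, trivial⟩)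

/-- Differentiation under the integral sign; the dominating constant is the maximum of `‖F'‖` over a
compact neighbourhood of `x₀` times the interval. -/
theorem hasDerivAt_intervalIntegral_param [NormedSpace ℝ G] {F F' : ℝ → ℝ → G} {U : Set ℝ} (hU : IsOpen U)
    (hF : ContinuousOn (Function.uncurry F) (U ×ˢ Set.univ))
    (hF' : ContinuousOn (Function.uncurry F') (U ×ˢ Set.univ))
    (hd : ∀ x ∈ U, ∀ t, HasDerivAt (fun x => F x t) (F' x t) x) {x₀ : ℝ} (hx₀ : x₀ ∈ U)
    (a b : ℝ) :
    HasDerivAt (fun x => ∫ t in a..b, F x t) (∫ t in a..b, F' x₀ t) x₀ := by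
  obtain ⟨δ, hδ, hball⟩ := Metric.nhds_basis_closedBall.mem_iff.1 (hU.mem_nhds hx₀)
  have hcpt : IsCompact (Metric.closedBall x₀ δ ×ˢ Set.uIcc a b) :=
    (isCompact_closedBall x₀ δ).prod isCompact_uIcc
  obtain ⟨C, hC⟩ := hcpt.exists_bound_of_continuousOn
    (hF'.mono (Set.prod_mono hball (Set.subset_univ _)))
  refine (intervalIntegral.hasDerivAt_integral_of_dominated_loc_of_deriv_le
    (bound := fun _ => C) (Metric.closedBall_mem_nhds x₀ hδ) ?_ ?_ ?_ ?_ ?_ ?_).2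
  · filter_upwards [hU.mem_nhds hx₀] with x hx
    exact (continuous_of_continuousOn_prod_univ hF hx).aestronglyMeasurable
  · exact (continuous_of_continuousOn_prod_univ hF hx₀).intervalIntegrable _ _
  · exact (continuous_of_continuousOn_prod_univ hF' hx₀).aestronglyMeasurable
  · exact Eventually.of_forall fun t ht x hx => hC (x, t) ⟨hx, Set.uIoc_subset_uIcc ht⟩
  · exact intervalIntegrable_const
  · exact Eventually.of_forall fun t ht x hx => hd x (hball hx) t

/-- Only the open interval enters, because nothing is known about `f` at the end `x = 1`. -/
theorem intervalIntegrable_of_continuousOn_Ioo_of_bound {g : ℝ → G} {a b M : ℝ} (hab : a ≤ b)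
    (hg : ContinuousOn g (Set.Ioo a b)) (hM : ∀ x ∈ Set.Ioo a b, ‖g x‖ ≤ M) :
    IntervalIntegrable g volume a b := by
  rw [intervalIntegrable_iff_integrableOn_Ioo_of_le hab]
  exact Integrable.of_bound (hg.aestronglyMeasurable measurableSet_Ioo) M
    ((ae_restrict_iff' measurableSet_Ioo).2 (Eventually.of_forall hM))

end ParametricIntegrals

/-! ### Fubini over the horn -/

section Horn

variable {f : ℝ → ℝ} {G : Type*} [NormedAddCommGroup G]

theorem isOpen_hornDomain (hc : ContinuousOn f (Set.Ioi 1)) : IsOpen (hornDomain f) := by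
  have hU : IsOpen {p : ℝ × ℝ | 1 < p.1} := isOpen_lt continuous_const continuous_fst
  have h : ContinuousOn (fun p : ℝ × ℝ => f p.1 - |p.2|) {p : ℝ × ℝ | 1 < p.1} :=
    (hc.comp continuousOn_fst fun p hp => hp).sub (by fun_prop)
  have := h.isOpen_inter_preimage hU isOpen_Ioi (t := Set.Ioi 0)
  convert! this using 1
  ext p
  simp [hornDomain]

/-- The integral of `g` over the section of the horn at `x`, in the coordinate `t = y / f x`. -/
noncomputable def fiberIntegral [NormedSpace ℝ G] (f : ℝ → ℝ) (g : ℝ × ℝ → G) (x : ℝ) : G :=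
  f x • ∫ t in (-1 : ℝ)..1, g (x, f x * t)

theorem fiberIntegral_nonneg (hpos : ∀ x > 1, 0 < f x) {g : ℝ × ℝ → ℝ} (hg : ∀ p, 0 ≤ g p) {x : ℝ}
    (hx : 1 < x) : 0 ≤ fiberIntegral f g x :=
  smul_nonneg (hpos x hx).le
    (intervalIntegral.integral_nonneg (by norm_num) fun t _ => hg _)

theorem continuousOn_comp_fiber (hc : ContinuousOn f (Set.Ioi 1)) {g : ℝ × ℝ → G}
    (hg : Continuous g) :
    ContinuousOn (Function.uncurry fun x t => g (x, f x * t)) (Set.Ioi 1 ×ˢ Set.univ) := by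
  refine hg.comp_continuousOn (continuousOn_fst.prodMk (ContinuousOn.mul ?_ continuousOn_snd))
  exact hc.comp continuousOn_fst fun p hp => hp.1

theorem continuousOn_fiberIntegral [NormedSpace ℝ G] (hc : ContinuousOn f (Set.Ioi 1)) {g : ℝ × ℝ → G}
    (hg : Continuous g) : ContinuousOn (fiberIntegral f g) (Set.Ioi 1) :=
  hc.smul (continuousOn_intervalIntegral_param (continuousOn_comp_fiber hc hg) _ _)

/-- The substitution `y = f x * t` replaces the moving slice `(-f x, f x)` by the fixed interval
`(-1, 1)`, so that slice integrals can be differentiated in `x`. -/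
theorem integral_indicator_hornDomain_fiber [NormedSpace ℝ G] (hpos : ∀ x > 1, 0 < f x) (g : ℝ × ℝ → G) (x : ℝ) :
    ∫ y, (hornDomain f).indicator g (x, y) = (Set.Ioi 1).indicator (fiberIntegral f g) x := by
  by_cases hx : 1 < x
  · have h1 : (fun y => (hornDomain f).indicator g (x, y)) =
        (Set.Ioo (-f x) (f x)).indicator fun y => g (x, y) := by
      ext y
      by_cases hy : |y| < f x
      · rw [Set.indicator_of_mem (show (x, y) ∈ hornDomain f from ⟨hx, hy⟩),
          Set.indicator_of_mem (show y ∈ Set.Ioo (-f x) (f x) from abs_lt.1 hy)]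
      · rw [Set.indicator_of_notMem (fun h => hy h.2),
          Set.indicator_of_notMem (fun h : y ∈ Set.Ioo _ _ => hy (abs_lt.2 h))]
    rw [h1, integral_indicator measurableSet_Ioo, Set.indicator_of_mem (Set.mem_Ioi.2 hx),
      fiberIntegral, intervalIntegral.smul_integral_comp_mul_left (f := fun y => g (x, y)),
      intervalIntegral.integral_of_le (by linarith [hpos x hx]), integral_Ioc_eq_integral_Ioo]
    simp
  · have h1 : (fun y => (hornDomain f).indicator g (x, y)) = fun _ => 0 := by
      ext y
      exact Set.indicator_of_notMem (fun h => hx h.1) _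
    rw [h1, Set.indicator_of_notMem (s := Set.Ioi 1) hx, integral_zero]

theorem integrableOn_fiberIntegral [NormedSpace ℝ G] (hc : ContinuousOn f (Set.Ioi 1)) (hpos : ∀ x > 1, 0 < f x)
    {g : ℝ × ℝ → G} (hg : Integrable g (hornMeasure f)) :
    IntegrableOn (fiberIntegral f g) (Set.Ioi 1) := by
  have hm := (isOpen_hornDomain hc).measurableSet
  rw [hornMeasure, ← IntegrableOn, ← integrable_indicator_iff hm] at hg
  have h := hg.integral_prod_left (μ := volume) (ν := volume)
  simp only [integral_indicator_hornDomain_fiber hpos] at h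
  exact (integrable_indicator_iff measurableSet_Ioi).1 h

theorem integral_hornMeasure [NormedSpace ℝ G] (hc : ContinuousOn f (Set.Ioi 1)) (hpos : ∀ x > 1, 0 < f x)
    {g : ℝ × ℝ → G} (hg : Integrable g (hornMeasure f)) :
    ∫ p, g p ∂(hornMeasure f) = ∫ x in Set.Ioi 1, fiberIntegral f g x := by
  have hm := (isOpen_hornDomain hc).measurableSet
  rw [hornMeasure, ← IntegrableOn, ← integrable_indicator_iff hm] at hg
  rw [hornMeasure, ← integral_indicator hm, Measure.volume_eq_prod, integral_prod _ hg]
  simp only [integral_indicator_hornDomain_fiber hpos]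
  rw [integral_indicator measurableSet_Ioi]

end Horn

/-! ### The chain rule in the coordinates `(x, y / f x)` -/

section Derivatives

variable {u : ℝ × ℝ → ℂ}

theorem continuous_partialX (hu : ContDiff ℝ 1 u) : Continuous (partialX u) :=
  (hu.continuous_fderiv one_ne_zero).clm_apply continuous_const

theorem continuous_partialY (hu : ContDiff ℝ 1 u) : Continuous (partialY u) :=
  (hu.continuous_fderiv one_ne_zero).clm_apply continuous_const

theorem hasDerivAt_comp_fiber (hu : ContDiff ℝ 1 u) {f : ℝ → ℝ} {x f' : ℝ}
    (hf : HasDerivAt f f' x) (t : ℝ) :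
    HasDerivAt (fun x => u (x, f x * t))
      (partialX u (x, f x * t) + (f' * t : ℝ) • partialY u (x, f x * t)) x := by
  have h1 := ((hu.differentiable one_ne_zero) (x, f x * t)).hasFDerivAt
  have h2 : HasDerivAt (fun x => (x, f x * t)) ((1 : ℝ), f' * t) x :=
    (hasDerivAt_id x).prodMk (hf.mul_const t)
  have h3 := h1.comp_hasDerivAt x h2
  convert! h3 using 1
  rw [partialX, partialY, ← map_smul, ← map_add]
  simp

theorem hasDerivAt_comp_mul (hu : ContDiff ℝ 1 u) (x c t : ℝ) :
    HasDerivAt (fun t => u (x, c * t)) (c • partialY u (x, c * t)) t := by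
  have h1 := ((hu.differentiable one_ne_zero) (x, c * t)).hasFDerivAt
  have h2 : HasDerivAt (fun t : ℝ => (x, c * t)) ((0 : ℝ), c) t :=
    (hasDerivAt_const t x).prodMk (by simpa using (hasDerivAt_id t).const_mul c)
  have h3 := h1.comp_hasDerivAt t h2
  convert! h3 using 1
  rw [partialY, ← map_smul]
  simp

end Derivatives

/-! ### Poincaré inequalities on intervals -/

section Poincare

/-- Cauchy–Schwarz, read off from the nonnegative variance of `h` about its mean `m`. -/
theorem sq_intervalIntegral_le {h : ℝ → ℝ} {a b : ℝ} (hab : a < b)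
    (hi : IntervalIntegrable h volume a b) (hi2 : IntervalIntegrable (fun x => h x ^ 2) volume a b) :
    (∫ x in a..b, h x) ^ 2 ≤ (b - a) * ∫ x in a..b, h x ^ 2 := by
  set m := (b - a)⁻¹ * ∫ x in a..b, h x with hm
  have h0 : 0 ≤ ∫ x in a..b, (h x - m) ^ 2 :=
    intervalIntegral.integral_nonneg hab.le fun x _ => sq_nonneg _
  have h1 : ∫ x in a..b, (h x - m) ^ 2 =
      (∫ x in a..b, h x ^ 2) - 2 * m * (∫ x in a..b, h x) + (b - a) * m ^ 2 := by
    have e : ∀ x, (h x - m) ^ 2 = h x ^ 2 - 2 * m * h x + m ^ 2 := fun x => by ring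
    simp only [e]
    rw [intervalIntegral.integral_add (hi2.sub (hi.const_mul _)) intervalIntegrable_const,
      intervalIntegral.integral_sub hi2 (hi.const_mul _), intervalIntegral.integral_const_mul,
      intervalIntegral.integral_const, smul_eq_mul]
  have hI : ∫ x in a..b, h x = (b - a) * m := by
    rw [hm, mul_inv_cancel_left₀ (sub_ne_zero.2 hab.ne')]
  rw [hI] at h1 ⊢
  have : 0 ≤ (b - a) * ((∫ x in a..b, h x ^ 2) - (b - a) * m ^ 2) :=
    mul_nonneg (sub_pos.2 hab).le (by linarith)
  nlinarith

theorem norm_sq_intervalIntegral_le {G : Type*} [NormedAddCommGroup G] [NormedSpace ℝ G]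
    {h : ℝ → G} {a b : ℝ} (hab : a < b)
    (hi : IntervalIntegrable h volume a b)
    (hi2 : IntervalIntegrable (fun x => ‖h x‖ ^ 2) volume a b) :
    ‖∫ x in a..b, h x‖ ^ 2 ≤ (b - a) * ∫ x in a..b, ‖h x‖ ^ 2 :=
  (pow_le_pow_left₀ (norm_nonneg _) (intervalIntegral.norm_integral_le_integral_norm hab.le) 2).trans
    (sq_intervalIntegral_le hab hi.norm hi2)

variable {g g' : ℝ → ℂ} {a b M : ℝ}

/-- A derivative is automatically measurable, so boundedness suffices. -/
theorem intervalIntegrable_of_hasDerivAt_of_bound (hab : a ≤ b)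
    (hd : ∀ x ∈ Set.Ioo a b, HasDerivAt g (g' x) x) (hM' : ∀ x ∈ Set.Ioo a b, ‖g' x‖ ≤ M) :
    IntervalIntegrable g' volume a b ∧ IntervalIntegrable (fun x => ‖g' x‖ ^ 2) volume a b := by
  rw [intervalIntegrable_iff_integrableOn_Ioo_of_le hab,
    intervalIntegrable_iff_integrableOn_Ioo_of_le hab]
  have hm : AEStronglyMeasurable g' (volume.restrict (Set.Ioo a b)) :=
    (stronglyMeasurable_deriv g).aestronglyMeasurable.congr
      ((ae_restrict_iff' measurableSet_Ioo).2 (Eventually.of_forall fun x hx => (hd x hx).deriv))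
  constructor
  · exact Integrable.of_bound hm M
      ((ae_restrict_iff' measurableSet_Ioo).2 (Eventually.of_forall hM'))
  · refine Integrable.of_bound (hm.norm.pow 2) (M ^ 2)
      ((ae_restrict_iff' measurableSet_Ioo).2 (Eventually.of_forall fun x hx => ?_))
    rw [Real.norm_of_nonneg (by positivity)]
    exact pow_le_pow_left₀ (norm_nonneg _) (hM' x hx) 2

theorem norm_sub_sq_le_of_hasDerivAt (hab : a < b)
    (hd : ∀ x ∈ Set.Ioo a b, HasDerivAt g (g' x) x) (hM' : ∀ x ∈ Set.Ioo a b, ‖g' x‖ ≤ M)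
    {x y : ℝ} (hx : x ∈ Set.Ioo a b) (hy : y ∈ Set.Ioo a b) :
    ‖g x - g y‖ ^ 2 ≤ (b - a) * ∫ s in a..b, ‖g' s‖ ^ 2 := by
  obtain ⟨hi, hi2⟩ := intervalIntegrable_of_hasDerivAt_of_bound hab.le hd hM'
  have hsub : Set.uIcc y x ⊆ Set.Ioo a b := Set.ordConnected_Ioo.uIcc_subset hy hx
  have h1 : ∫ s in y..x, g' s = g x - g y :=
    intervalIntegral.integral_eq_sub_of_hasDerivAt (fun s hs => hd s (hsub hs))
      (hi.mono_set ((hsub.trans Set.Ioo_subset_Icc_self).trans (Set.uIcc_of_le hab.le).ge))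
  have h2 : ‖∫ s in y..x, g' s‖ ≤ ∫ s in a..b, ‖g' s‖ := by
    rw [intervalIntegral.norm_integral_eq_norm_integral_uIoc,
      intervalIntegral.integral_of_le hab.le]
    refine (norm_integral_le_integral_norm _).trans (setIntegral_mono_set
      ((intervalIntegrable_iff_integrableOn_Ioc_of_le hab.le).1 hi.norm)
      (Eventually.of_forall fun _ => norm_nonneg _) (LE.le.eventuallyLE ?_))
    exact (Set.uIoc_subset_uIcc.trans hsub).trans Set.Ioo_subset_Ioc_self
  rw [← h1]
  exact (pow_le_pow_left₀ (norm_nonneg _) h2 2).trans (sq_intervalIntegral_le hab hi.norm hi2)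

/-- A Poincaré inequality on an interval. -/
theorem integral_norm_sq_le_poincare (hab : a < b)
    (hd : ∀ x ∈ Set.Ioo a b, HasDerivAt g (g' x) x) (hM' : ∀ x ∈ Set.Ioo a b, ‖g' x‖ ≤ M)
    (hM : ∀ x ∈ Set.Ioo a b, ‖g x‖ ≤ M) :
    ∫ x in a..b, ‖g x‖ ^ 2 ≤ 2 * (b - a) ^ 2 * (∫ x in a..b, ‖g' x‖ ^ 2) +
      2 * (b - a)⁻¹ * ‖∫ x in a..b, g x‖ ^ 2 := by
  have hba : 0 < b - a := sub_pos.2 hab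
  have hc : ContinuousOn g (Set.Ioo a b) := fun x hx => (hd x hx).continuousAt.continuousWithinAt
  have hi : IntervalIntegrable g volume a b :=
    intervalIntegrable_of_continuousOn_Ioo_of_bound hab.le hc hM
  set S := (b - a) * ∫ s in a..b, ‖g' s‖ ^ 2 with hS
  have hS0 : 0 ≤ S := mul_nonneg hba.le
    (intervalIntegral.integral_nonneg hab.le fun _ _ => by positivity)
  have hpt : ∀ x ∈ Set.Ioo a b, ‖g x - (b - a)⁻¹ • ∫ y in a..b, g y‖ ≤ √S := by
    intro x hx
    -- The deviation from the mean is the mean of the differences `g x - g y`, each bounded by `√S`.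
    have e : g x - (b - a)⁻¹ • ∫ y in a..b, g y = (b - a)⁻¹ • ∫ y in a..b, (g x - g y) := by
      rw [intervalIntegral.integral_sub intervalIntegrable_const hi, intervalIntegral.integral_const,
        smul_sub, inv_smul_smul₀ hba.ne']
    have h1 : ‖∫ y in a..b, (g x - g y)‖ ≤ √S * |b - a| := by
      refine intervalIntegral.norm_integral_le_of_norm_le_const_ae ?_
      -- The half-open interval contains `b`, where `g` is not controlled.
      have hb : ∀ᵐ y : ℝ, y ≠ b := by simp [ae_iff]
      filter_upwards [hb] with y hyb hy
      rw [Set.uIoc_of_le hab.le] at hy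
      exact Real.le_sqrt_of_sq_le
        (norm_sub_sq_le_of_hasDerivAt hab hd hM' hx ⟨hy.1, lt_of_le_of_ne hy.2 hyb⟩)
    rw [e, norm_smul, norm_inv, Real.norm_of_nonneg hba.le, inv_mul_le_iff₀ hba]
    rw [abs_of_pos hba] at h1
    linarith
  have hpt2 : ∀ x ∈ Set.Ioo a b,
      ‖g x‖ ^ 2 ≤ 2 * S + 2 * ((b - a)⁻¹ * ‖∫ y in a..b, g y‖) ^ 2 := by
    intro x hx
    have h1 := hpt x hx
    have h2 : ‖g x‖ ≤ √S + (b - a)⁻¹ * ‖∫ y in a..b, g y‖ := by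
      have h3 := norm_add_le (g x - (b - a)⁻¹ • ∫ y in a..b, g y) ((b - a)⁻¹ • ∫ y in a..b, g y)
      rw [sub_add_cancel, norm_smul, norm_inv, Real.norm_of_nonneg hba.le] at h3
      linarith
    have h4 := Real.sq_sqrt hS0
    nlinarith [pow_le_pow_left₀ (norm_nonneg _) h2 2,
      sq_nonneg (√S - (b - a)⁻¹ * ‖∫ y in a..b, g y‖)]
  have hi2 : IntervalIntegrable (fun x => ‖g x‖ ^ 2) volume a b :=
    intervalIntegrable_of_continuousOn_Ioo_of_bound (M := M ^ 2) hab.le (hc.norm.pow 2)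
      fun x hx => by
        rw [Real.norm_of_nonneg (by positivity)]
        exact pow_le_pow_left₀ (norm_nonneg _) (hM x hx) 2
  have h5 := intervalIntegral.integral_mono_on_of_le_Ioo hab.le hi2
    (intervalIntegrable_const (c := 2 * S + 2 * ((b - a)⁻¹ * ‖∫ y in a..b, g y‖) ^ 2)) hpt2
  rw [intervalIntegral.integral_const, smul_eq_mul] at h5
  refine h5.trans (le_of_eq ?_)
  rw [hS]
  field_simp

/-- An interval can be cut into finitely many pieces such that the `L²` norm is controlled by a
small multiple of the norm of the derivative and the integrals over the pieces. -/
theorem exists_partition_integral_norm_sq_le (hab : a < b) {ε : ℝ} (hε : 0 < ε) :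
    ∃ (n : ℕ) (C : ℝ) (c : ℕ → ℝ), 0 ≤ C ∧ (∀ i < n, a ≤ c i ∧ c i < c (i + 1) ∧ c (i + 1) ≤ b) ∧
      ∀ (g g' : ℝ → ℂ) (M : ℝ), (∀ x ∈ Set.Ioo a b, HasDerivAt g (g' x) x) →
        (∀ x ∈ Set.Ioo a b, ‖g' x‖ ≤ M) → (∀ x ∈ Set.Ioo a b, ‖g x‖ ≤ M) →
        ∫ x in a..b, ‖g x‖ ^ 2 ≤ ε * (∫ x in a..b, ‖g' x‖ ^ 2) +
          C * ∑ i ∈ Finset.range n, ‖∫ x in c i..c (i + 1), g x‖ ^ 2 := by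
  have hba : 0 < b - a := sub_pos.2 hab
  -- The Poincaré constant of a piece of length `h = (b - a) / n` is `2 h²`; since `n > 1` gives `n
  -- ≤ n²`, the bound `n > 2 (b - a)² / ε` makes it at most `ε`.
  obtain ⟨n, hn⟩ := exists_nat_gt (max 1 (2 * (b - a) ^ 2 / ε))
  have hn1 : (1 : ℝ) < n := (le_max_left _ _).trans_lt hn
  have hn0 : (0 : ℝ) < n := by linarith
  set h := (b - a) / n with hh
  have hh0 : 0 < h := by positivity
  have hhε : 2 * h ^ 2 ≤ ε := by
    have h1 : 2 * (b - a) ^ 2 / ε < n := (le_max_right _ _).trans_lt hn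
    rw [div_lt_iff₀ hε] at h1
    rw [hh, div_pow, ← mul_div_assoc, div_le_iff₀ (by positivity)]
    nlinarith
  let c : ℕ → ℝ := fun i => a + i * h
  have hc0 : c 0 = a := by simp [c]
  have hcn : c n = b := by simp only [c, hh]; field_simp; ring
  have hstep : ∀ i, c (i + 1) - c i = h := fun i => by simp only [c]; push_cast; ring
  have hmono : Monotone c := monotone_nat_of_le_succ fun i => by linarith [hstep i]
  have hci : ∀ i < n, a ≤ c i ∧ c i < c (i + 1) ∧ c (i + 1) ≤ b := fun i hi =>
    ⟨hc0 ▸ hmono (Nat.zero_le i), by linarith [hstep i], hcn ▸ hmono (Nat.succ_le_of_lt hi)⟩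
  refine ⟨n, 2 * h⁻¹, c, by positivity, hci, fun g g' M hd hM' hM => ?_⟩
  have hcg : ContinuousOn g (Set.Ioo a b) := fun x hx => (hd x hx).continuousAt.continuousWithinAt
  have hi2 : IntervalIntegrable (fun x => ‖g x‖ ^ 2) volume a b :=
    intervalIntegrable_of_continuousOn_Ioo_of_bound (M := M ^ 2) hab.le (hcg.norm.pow 2)
      fun x hx => by
        rw [Real.norm_of_nonneg (by positivity)]
        exact pow_le_pow_left₀ (norm_nonneg _) (hM x hx) 2
  have hi2' := (intervalIntegrable_of_hasDerivAt_of_bound hab.le hd hM').2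
  have hsub : ∀ i < n, Set.uIcc (c i) (c (i + 1)) ⊆ Set.uIcc a b := fun i hi => by
    rw [Set.uIcc_of_le (hci i hi).2.1.le, Set.uIcc_of_le hab.le]
    exact Set.Icc_subset_Icc (hci i hi).1 (hci i hi).2.2
  have hsum := intervalIntegral.sum_integral_adjacent_intervals (a := c) (n := n)
    (fun k hk => hi2.mono_set (hsub k hk))
  have hsum' := intervalIntegral.sum_integral_adjacent_intervals (a := c) (n := n)
    (fun k hk => hi2'.mono_set (hsub k hk))
  rw [hc0, hcn] at hsum hsum'
  rw [← hsum, ← hsum', Finset.mul_sum, Finset.mul_sum, ← Finset.sum_add_distrib]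
  refine Finset.sum_le_sum fun i hi => ?_
  have hi' := Finset.mem_range.1 hi
  have hIoo : Set.Ioo (c i) (c (i + 1)) ⊆ Set.Ioo a b :=
    Set.Ioo_subset_Ioo (hci i hi').1 (hci i hi').2.2
  have key := integral_norm_sq_le_poincare (g := g) (g' := g') (M := M) (hci i hi').2.1
    (fun x hx => hd x (hIoo hx)) (fun x hx => hM' x (hIoo hx)) (fun x hx => hM x (hIoo hx))
  rw [hstep] at key
  refine key.trans ?_
  have : 0 ≤ ∫ x in c i..c (i + 1), ‖g' x‖ ^ 2 :=
    intervalIntegral.integral_nonneg (hci i hi').2.1.le fun _ _ => by positivity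
  gcongr

end Poincare

/-! ### A Poincaré inequality on a rectangle -/

section Rectangle

theorem intervalIntegrable_intervalIntegral_param {G : Type*} [NormedAddCommGroup G]
    [NormedSpace ℝ G] {F : ℝ → ℝ → G} {R B a b : ℝ} (hR : 1 ≤ R) (ha : -1 ≤ a) (hab : a ≤ b)
    (hb : b ≤ 1) (hF : ContinuousOn (Function.uncurry F) (Set.Ioi 1 ×ˢ Set.univ))
    (hB : ∀ x ∈ Set.Ioo 1 R, ∀ t ∈ Set.Icc (-1 : ℝ) 1, ‖F x t‖ ≤ B) :
    IntervalIntegrable (fun x => ∫ t in a..b, F x t) volume 1 R := by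
  refine intervalIntegrable_of_continuousOn_Ioo_of_bound (M := B * |b - a|) hR
    ((continuousOn_intervalIntegral_param hF _ _).mono Set.Ioo_subset_Ioi_self) fun x hx => ?_
  refine intervalIntegral.norm_integral_le_of_norm_le_const fun t ht => hB x hx t ?_
  rw [Set.uIoc_of_le hab] at ht
  exact ⟨by linarith [ht.1], ht.2.trans hb⟩

/-- A Poincaré inequality on `(1, R) × (-1, 1)` modulo finitely many integrals over rectangles. -/
theorem exists_partition_integral_rectangle_le {R ε : ℝ} (hR : 1 < R) (hε : 0 < ε) :
    ∃ (n m : ℕ) (C : ℝ) (c d : ℕ → ℝ), 0 ≤ C ∧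
      (∀ i < n, 1 ≤ c i ∧ c i < c (i + 1) ∧ c (i + 1) ≤ R) ∧
      (∀ j < m, -1 ≤ d j ∧ d j < d (j + 1) ∧ d (j + 1) ≤ 1) ∧
      ∀ (w wx wt : ℝ → ℝ → ℂ) (M : ℝ),
        ContinuousOn (Function.uncurry w) (Set.Ioi 1 ×ˢ Set.univ) →
        ContinuousOn (Function.uncurry wx) (Set.Ioi 1 ×ˢ Set.univ) →
        ContinuousOn (Function.uncurry wt) (Set.Ioi 1 ×ˢ Set.univ) →
        (∀ x ∈ Set.Ioi 1, ∀ t, HasDerivAt (fun x => w x t) (wx x t) x) →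
        (∀ x ∈ Set.Ioi 1, ∀ t, HasDerivAt (fun t => w x t) (wt x t) t) →
        (∀ x ∈ Set.Ioo 1 R, ∀ t ∈ Set.Icc (-1 : ℝ) 1,
          ‖w x t‖ ≤ M ∧ ‖wx x t‖ ≤ M ∧ ‖wt x t‖ ≤ M) →
        ∫ x in (1 : ℝ)..R, ∫ t in (-1 : ℝ)..1, ‖w x t‖ ^ 2 ≤
          ε * (∫ x in (1 : ℝ)..R, ∫ t in (-1 : ℝ)..1, (‖wx x t‖ ^ 2 + ‖wt x t‖ ^ 2)) +
          C * ∑ j ∈ Finset.range m, ∑ i ∈ Finset.range n,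
            ‖∫ x in c i..c (i + 1), ∫ t in d j..d (j + 1), w x t‖ ^ 2 := by
  obtain ⟨m, C₁, d, hC₁, hd, h₁⟩ :=
    exists_partition_integral_norm_sq_le (show (-1 : ℝ) < 1 by norm_num) hε
  -- The interval in `t` is cut first; the inequality in `x` is then applied to the integral over
  -- each of the `m` strips. These errors return with weight `C₁`, and with a factor `2` from
  -- Cauchy–Schwarz on a strip of length at most `2`. Dividing `ε` by `2 m C₁ + 1` keeps their sum
  -- below `ε`.
  have hden : 0 < 2 * m * C₁ + 1 := by positivity
  obtain ⟨n, C₂, c, hC₂, hc, h₂⟩ :=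
    exists_partition_integral_norm_sq_le hR (div_pos hε hden)
  refine ⟨n, m, C₁ * C₂, c, d, by positivity, hc, hd, ?_⟩
  intro w wx wt M hw hwx hwt hdx hdt hM
  have hR' : (1 : ℝ) ≤ R := hR.le
  have hsq : ∀ {z : ℂ}, ‖z‖ ≤ M → ‖‖z‖ ^ 2‖ ≤ M ^ 2 := fun {z} hz => by
    rw [Real.norm_of_nonneg (by positivity)]
    exact pow_le_pow_left₀ (norm_nonneg _) hz 2
  have hm1 : (-1 : ℝ) ≤ 1 := by norm_num
  have nsq : ∀ {v : ℝ → ℝ → ℂ}, ContinuousOn (Function.uncurry v) (Set.Ioi 1 ×ˢ Set.univ) →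
      ContinuousOn (Function.uncurry fun x t => ‖v x t‖ ^ 2) (Set.Ioi 1 ×ˢ Set.univ) :=
    fun h => (h.norm.pow 2).congr fun _ _ => rfl
  have iw := intervalIntegrable_intervalIntegral_param (F := fun x t => ‖w x t‖ ^ 2) hR' le_rfl hm1
    le_rfl (nsq hw) (fun x hx t ht => hsq (hM x hx t ht).1)
  have iwx := intervalIntegrable_intervalIntegral_param (F := fun x t => ‖wx x t‖ ^ 2) hR' le_rfl hm1
    le_rfl (nsq hwx) (fun x hx t ht => hsq (hM x hx t ht).2.1)
  have iwt := intervalIntegrable_intervalIntegral_param (F := fun x t => ‖wt x t‖ ^ 2) hR' le_rfl hm1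
    le_rfl (nsq hwt) (fun x hx t ht => hsq (hM x hx t ht).2.2)
  set Ix := ∫ x in (1 : ℝ)..R, ∫ t in (-1 : ℝ)..1, ‖wx x t‖ ^ 2 with hIx
  set It := ∫ x in (1 : ℝ)..R, ∫ t in (-1 : ℝ)..1, ‖wt x t‖ ^ 2 with hIt
  have hsplit : ∫ x in (1 : ℝ)..R, ∫ t in (-1 : ℝ)..1, (‖wx x t‖ ^ 2 + ‖wt x t‖ ^ 2) = Ix + It := by
    rw [hIx, hIt, ← intervalIntegral.integral_add iwx iwt]
    refine intervalIntegral.integral_congr_ae (Eventually.of_forall fun x hx => ?_)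
    rw [Set.uIoc_of_le hR'] at hx
    exact intervalIntegral.integral_add
      (((continuous_of_continuousOn_prod_univ hwx hx.1).norm.pow 2).intervalIntegrable _ _)
      (((continuous_of_continuousOn_prod_univ hwt hx.1).norm.pow 2).intervalIntegrable _ _)
  rw [hsplit]
  have hIx0 : 0 ≤ Ix := intervalIntegral.integral_nonneg hR' fun _ _ =>
    intervalIntegral.integral_nonneg hm1 fun _ _ => by positivity
  -- Strip integrals of `w`, and their derivatives in `x`.
  let p : ℕ → ℝ → ℂ := fun j x => ∫ t in d j..d (j + 1), w x t
  let p' : ℕ → ℝ → ℂ := fun j x => ∫ t in d j..d (j + 1), wx x t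
  have hIcc : ∀ j < m, ∀ t ∈ Set.uIoc (d j) (d (j + 1)), t ∈ Set.Icc (-1 : ℝ) 1 := fun j hj t ht => by
    rw [Set.uIoc_of_le (hd j hj).2.1.le] at ht
    exact ⟨by linarith [ht.1, (hd j hj).1], ht.2.trans (hd j hj).2.2⟩
  have hM0 : 0 ≤ M := by
    have := (hM ((1 + R) / 2) ⟨by linarith, by linarith⟩ 0 (by norm_num)).1
    exact (norm_nonneg _).trans this
  have hlen : ∀ j < m, |d (j + 1) - d j| ≤ 2 := fun j hj => by
    obtain ⟨h1, h2, h3⟩ := hd j hj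
    rw [abs_of_pos (by linarith)]
    linarith
  have hpb : ∀ j < m, ∀ x ∈ Set.Ioo 1 R, ‖p j x‖ ≤ M * 2 := fun j hj x hx =>
    (intervalIntegral.norm_integral_le_of_norm_le_const fun t ht =>
      (hM x hx t (hIcc j hj t ht)).1).trans (mul_le_mul_of_nonneg_left (hlen j hj) hM0)
  have hpb' : ∀ j < m, ∀ x ∈ Set.Ioo 1 R, ‖p' j x‖ ≤ M * 2 := fun j hj x hx =>
    (intervalIntegral.norm_integral_le_of_norm_le_const fun t ht =>
      (hM x hx t (hIcc j hj t ht)).2.1).trans (mul_le_mul_of_nonneg_left (hlen j hj) hM0)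
  have hpc : ∀ j, ContinuousOn (p j) (Set.Ioo 1 R) := fun j =>
    (continuousOn_intervalIntegral_param hw _ _).mono Set.Ioo_subset_Ioi_self
  have hpc' : ∀ j, ContinuousOn (p' j) (Set.Ioo 1 R) := fun j =>
    (continuousOn_intervalIntegral_param hwx _ _).mono Set.Ioo_subset_Ioi_self
  have ip : ∀ j < m, IntervalIntegrable (fun x => ‖p j x‖ ^ 2) volume 1 R := fun j hj =>
    intervalIntegrable_of_continuousOn_Ioo_of_bound (M := (M * 2) ^ 2) hR' ((hpc j).norm.pow 2)
      fun x hx => by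
        rw [Real.norm_of_nonneg (by positivity)]
        exact pow_le_pow_left₀ (norm_nonneg _) (hpb j hj x hx) 2
  have ip' : ∀ j < m, IntervalIntegrable (fun x => ‖p' j x‖ ^ 2) volume 1 R := fun j hj =>
    intervalIntegrable_of_continuousOn_Ioo_of_bound (M := (M * 2) ^ 2) hR' ((hpc' j).norm.pow 2)
      fun x hx => by
        rw [Real.norm_of_nonneg (by positivity)]
        exact pow_le_pow_left₀ (norm_nonneg _) (hpb' j hj x hx) 2
  have step1 : ∫ x in (1 : ℝ)..R, ∫ t in (-1 : ℝ)..1, ‖w x t‖ ^ 2 ≤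
      ε * It + C₁ * ∑ j ∈ Finset.range m, ∫ x in (1 : ℝ)..R, ‖p j x‖ ^ 2 := by
    have isum : IntervalIntegrable (fun x => ∑ j ∈ Finset.range m, ‖p j x‖ ^ 2) volume 1 R := by
      convert! IntervalIntegrable.sum (Finset.range m) (f := fun j x => ‖p j x‖ ^ 2)
        (fun j hj => ip j (Finset.mem_range.1 hj)) using 1
      ext x
      simp
    have h := intervalIntegral.integral_mono_on_of_le_Ioo hR' iw
      ((iwt.const_mul ε).add (isum.const_mul C₁)) fun x hx => h₁ (w x) (wt x) M
        (fun t _ => hdt x hx.1 t) (fun t ht => (hM x hx t (Set.Ioo_subset_Icc_self ht)).2.2)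
        (fun t ht => (hM x hx t (Set.Ioo_subset_Icc_self ht)).1)
    rwa [intervalIntegral.integral_add (iwt.const_mul ε) (isum.const_mul C₁),
      intervalIntegral.integral_const_mul, intervalIntegral.integral_const_mul,
      intervalIntegral.integral_finsetSum (fun j hj => ip j (Finset.mem_range.1 hj))] at h
  have step2 : ∀ j < m, ∫ x in (1 : ℝ)..R, ‖p' j x‖ ^ 2 ≤ 2 * Ix := by
    intro j hj
    rw [hIx, ← intervalIntegral.integral_const_mul]
    refine intervalIntegral.integral_mono_on_of_le_Ioo hR' (ip' j hj) (iwx.const_mul 2)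
      fun x hx => ?_
    have hcx := continuous_of_continuousOn_prod_univ hwx (show x ∈ Set.Ioi 1 from hx.1)
    have hcx2 : Continuous fun t => ‖wx x t‖ ^ 2 := hcx.norm.pow 2
    obtain ⟨h1, h2, h3⟩ := hd j hj
    refine (norm_sq_intervalIntegral_le h2 (hcx.intervalIntegrable _ _)
      (hcx2.intervalIntegrable _ _)).trans ?_
    have hnn : 0 ≤ ∫ t in d j..d (j + 1), ‖wx x t‖ ^ 2 :=
      intervalIntegral.integral_nonneg h2.le fun _ _ => by positivity
    refine mul_le_mul (by linarith) ?_ hnn (by norm_num)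
    exact intervalIntegral.integral_mono_interval h1 h2.le h3
      (Eventually.of_forall fun _ => by positivity) (hcx2.intervalIntegrable _ _)
  have step3 : ∀ j < m, ∫ x in (1 : ℝ)..R, ‖p j x‖ ^ 2 ≤ ε / (2 * m * C₁ + 1) * (2 * Ix) +
      C₂ * ∑ i ∈ Finset.range n, ‖∫ x in c i..c (i + 1), p j x‖ ^ 2 := fun j hj =>
    (h₂ (p j) (p' j) (M * 2) (fun x hx => hasDerivAt_intervalIntegral_param isOpen_Ioi hw hwx hdx
      hx.1 _ _) (hpb' j hj) (hpb j hj)).trans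
      (by gcongr; exact step2 j hj)
  have step4 : C₁ * ∑ j ∈ Finset.range m, ∫ x in (1 : ℝ)..R, ‖p j x‖ ^ 2 ≤
      C₁ * ∑ j ∈ Finset.range m, (ε / (2 * m * C₁ + 1) * (2 * Ix) +
      C₂ * ∑ i ∈ Finset.range n, ‖∫ x in c i..c (i + 1), p j x‖ ^ 2) :=
    mul_le_mul_of_nonneg_left
      (Finset.sum_le_sum fun j hj => step3 j (Finset.mem_range.1 hj)) hC₁
  rw [Finset.sum_add_distrib, Finset.sum_const, Finset.card_range, nsmul_eq_mul,
    ← Finset.mul_sum] at step4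
  have step5 : C₁ * (m * (ε / (2 * m * C₁ + 1) * (2 * Ix))) ≤ ε * Ix := by
    have e : C₁ * (m * (ε / (2 * m * C₁ + 1) * (2 * Ix))) =
        (2 * m * C₁) / (2 * m * C₁ + 1) * (ε * Ix) := by field_simp
    rw [e]
    refine mul_le_of_le_one_left (by positivity) ?_
    rw [div_le_one hden]
    linarith
  rw [mul_add] at step4
  have e : ∀ j i, ∫ x in c i..c (i + 1), ∫ t in d j..d (j + 1), w x t =
    ∫ x in c i..c (i + 1), p j x := fun _ _ => rfl
  simp only [e]
  linarith [mul_assoc C₁ C₂ (∑ j ∈ Finset.range m, ∑ i ∈ Finset.range n,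
    ‖∫ x in c i..c (i + 1), p j x‖ ^ 2)]

end Rectangle

/-! ### Bounds for the profile on `(1, R]` -/

section Profile

variable {f : ℝ → ℝ}

theorem IsCuspProfile.contDiffAt (hf : IsCuspProfile f) {x : ℝ} (hx : 1 < x) : ContDiffAt ℝ ∞ f x :=
  hf.smooth.contDiffAt (Ioi_mem_nhds hx)

theorem IsCuspProfile.differentiableAt (hf : IsCuspProfile f) {x : ℝ} (hx : 1 < x) :
    DifferentiableAt ℝ f x :=
  (hf.contDiffAt hx).differentiableAt (by simp)

theorem IsCuspProfile.continuousOn (hf : IsCuspProfile f) : ContinuousOn f (Set.Ioi 1) :=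
  hf.smooth.continuousOn

theorem IsCuspProfile.contDiffOn_deriv (hf : IsCuspProfile f) :
    ContDiffOn ℝ ∞ (deriv f) (Set.Ioi 1) :=
  hf.smooth.deriv_of_isOpen isOpen_Ioi (by simp)

theorem IsCuspProfile.continuousOn_deriv (hf : IsCuspProfile f) :
    ContinuousOn (deriv f) (Set.Ioi 1) :=
  hf.contDiffOn_deriv.continuousOn

/-- Away from `1` this is compactness. Near `1` the regularity assumption gives the lower bound and
the bound on `f'`, and the latter bounds `f` from above by the mean value inequality. -/
theorem IsCuspProfile.exists_bounds (hf : IsCuspProfile f) (hreg : IsRegularAtOne f) (R : ℝ) :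
    ∃ c M L : ℝ, 0 < c ∧ 0 < M ∧ 0 ≤ L ∧
      ∀ x ∈ Set.Ioc 1 R, c ≤ f x ∧ f x ≤ M ∧ |deriv f x| ≤ L := by
  obtain ⟨c₀, L₀, hc₀, h⟩ := hreg
  obtain ⟨b, hb1, hb⟩ := (mem_nhdsGT_iff_exists_Ioo_subset).1 h
  have hb1 : 1 < b := hb1
  set m := (1 + b) / 2 with hm
  have hm1 : 1 < m := by rw [hm]; linarith
  have hmb : m < b := by rw [hm]; linarith
  have hsub : Set.Icc m R ⊆ Set.Ioi 1 := fun x hx => hm1.trans_le hx.1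
  obtain ⟨M₁, hM₁⟩ := isCompact_Icc.exists_bound_of_continuousOn (hf.continuousOn.mono hsub)
  obtain ⟨L₁, hL₁⟩ := isCompact_Icc.exists_bound_of_continuousOn (hf.continuousOn_deriv.mono hsub)
  obtain ⟨c₁, hc₁, hc₁'⟩ : ∃ c₁ > 0, ∀ x ∈ Set.Icc m R, c₁ ≤ f x := by
    rcases (Set.Icc m R).eq_empty_or_nonempty with he | hne
    · exact ⟨1, one_pos, by simp [he]⟩
    · obtain ⟨y, hy, hmin⟩ := isCompact_Icc.exists_isMinOn hne (hf.continuousOn.mono hsub)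
      exact ⟨f y, hf.pos y (hsub hy), fun x hx => hmin hx⟩
  have hnear : ∀ x ∈ Set.Ioo 1 b, f x ≤ f m + L₀ * |x - m| := by
    intro x hx
    have := (convex_Ioo 1 b).norm_image_sub_le_of_norm_deriv_le (f := f) (C := L₀)
      (fun y hy => hf.differentiableAt hy.1) (fun y hy => (hb hy).2)
      (show m ∈ Set.Ioo 1 b from ⟨hm1, hmb⟩) hx
    rw [Real.norm_eq_abs, Real.norm_eq_abs] at this
    linarith [le_abs_self (f x - f m)]
  have hL₀ : 0 ≤ L₀ := (abs_nonneg _).trans (hb ⟨hm1, hmb⟩).2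
  refine ⟨min c₀ c₁, max (f m + L₀ * (b - 1)) (max M₁ 1), max L₀ L₁, lt_min hc₀ hc₁,
    lt_of_lt_of_le one_pos ((le_max_right _ _).trans (le_max_right _ _)),
    hL₀.trans (le_max_left _ _), fun x hx => ?_⟩
  by_cases hxm : x < m
  · have hxb : x ∈ Set.Ioo 1 b := ⟨hx.1, hxm.trans hmb⟩
    refine ⟨(min_le_left _ _).trans (hb hxb).1, le_trans ?_ (le_max_left _ _),
      (hb hxb).2.trans (le_max_left _ _)⟩
    refine (hnear x hxb).trans ?_
    gcongr
    rw [abs_le]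
    constructor <;> linarith [hx.1]
  · have hxI : x ∈ Set.Icc m R := ⟨not_lt.1 hxm, hx.2⟩
    exact ⟨(min_le_right _ _).trans (hc₁' x hxI), (le_abs_self _).trans ((hM₁ x hxI).trans
      ((le_max_left _ _).trans (le_max_right _ _))), (hL₁ x hxI).trans (le_max_right _ _)⟩

end Profile

/-! ### Cell integrals as functionals on `L²(Ω)` -/

section Functionals

variable {f : ℝ → ℝ}

/-- The integral over a rectangle in the coordinates `(x, y / f x)` is a bounded functional. -/
theorem exists_inner_eq_integral_rectangle (hc : ContinuousOn f (Set.Ioi 1))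
    (hpos : ∀ x > 1, 0 < f x) {R c M α β γ δ : ℝ} (hc0 : 0 < c)
    (hb : ∀ x ∈ Set.Ioc 1 R, c ≤ f x ∧ f x ≤ M) (hα : 1 ≤ α) (hαβ : α ≤ β) (hβ : β ≤ R)
    (hγ : -1 ≤ γ) (hγδ : γ ≤ δ) (hδ : δ ≤ 1) :
    ∃ g : Lp ℂ 2 (hornMeasure f), ∀ (u : ℝ × ℝ → ℂ) (hu : MemLp u 2 (hornMeasure f)),
      inner ℂ g (hu.toLp u) = ∫ x in α..β, ∫ t in γ..δ, u (x, f x * t) := by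
  have hm := (isOpen_hornDomain hc).measurableSet
  -- The indicator of the cell in the coordinates `(x, t)`; the factor `1 / f` cancels the Jacobian
  -- `dy = f dt`.
  let k : ℝ × ℝ → ℝ := fun p => (Set.Ioc α β ×ˢ Set.Ioc γ δ).indicator (fun _ => 1) (p.1, p.2 / f p.1)
    * (f p.1)⁻¹
  have hcf : ContinuousOn (fun p : ℝ × ℝ => f p.1) (hornDomain f) :=
    hc.comp continuousOn_fst fun p hp => hp.1
  have hf0 : ∀ p ∈ hornDomain f, f p.1 ≠ 0 := fun p hp => (hpos _ hp.1).ne'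
  have hkm : AEMeasurable k (hornMeasure f) := by
    have h1 : AEMeasurable (fun p : ℝ × ℝ => (p.1, p.2 / f p.1)) (hornMeasure f) :=
      (continuousOn_fst.prodMk (continuousOn_snd.div hcf hf0)).aemeasurable hm
    have h2 : AEMeasurable (fun p : ℝ × ℝ => (f p.1)⁻¹) (hornMeasure f) :=
      (hcf.inv₀ hf0).aemeasurable hm
    exact ((measurable_const.indicator
      (measurableSet_Ioc.prod measurableSet_Ioc)).comp_aemeasurable h1).mul h2
  -- The horn may have infinite area, but within it `k` is supported in this bounded box and is at
  -- most `c⁻¹`, hence square integrable.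
  let S : Set (ℝ × ℝ) := Set.Ioc 1 R ×ˢ Set.Icc (-M) M
  have hS : MeasurableSet S := measurableSet_Ioc.prod measurableSet_Icc
  have hSfin : hornMeasure f S ≠ ⊤ := by
    refine ne_top_of_le_ne_top ?_ (Measure.restrict_apply_le (hornDomain f) S)
    rw [Measure.volume_eq_prod, Measure.prod_prod]
    simp [ENNReal.mul_eq_top]
  have hk2 : MemLp (fun p => (k p : ℂ)) 2 (hornMeasure f) := by
    refine (memLp_indicator_const 2 hS c⁻¹ (Or.inr hSfin)).mono'
      (Complex.measurable_ofReal.comp_aemeasurable hkm).aestronglyMeasurable ?_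
    rw [hornMeasure]
    refine (ae_restrict_iff' hm).2 (Eventually.of_forall fun p hp => ?_)
    by_cases hI : (p.1, p.2 / f p.1) ∈ Set.Ioc α β ×ˢ Set.Ioc γ δ
    · have hx : p.1 ∈ Set.Ioc 1 R := ⟨hp.1, hI.1.2.trans hβ⟩
      have hpS : p ∈ S := ⟨hx, abs_le.1 (hp.2.le.trans (hb _ hx).2)⟩
      rw [Set.indicator_of_mem hpS]
      simp only [k]
      rw [Set.indicator_of_mem hI, one_mul, Complex.norm_real, norm_inv,
        Real.norm_of_nonneg (hpos _ hp.1).le]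
      exact inv_anti₀ hc0 (hb _ hx).1
    · simp only [k]
      rw [Set.indicator_of_notMem hI]
      simp only [zero_mul, Complex.ofReal_zero, norm_zero]
      exact Set.indicator_nonneg (fun _ _ => (inv_pos.2 hc0).le) _
  refine ⟨hk2.toLp _, fun u hu => ?_⟩
  have h1 : inner ℂ (hk2.toLp _) (hu.toLp u) = ∫ p, (k p : ℂ) * u p ∂(hornMeasure f) := by
    rw [L2.inner_def]
    refine integral_congr_ae ?_
    filter_upwards [hk2.coeFn_toLp, hu.coeFn_toLp] with p h1 h2
    rw [h1, h2]
    simp [mul_comm]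
  have hint : Integrable (fun p => (k p : ℂ) * u p) (hornMeasure f) := hk2.integrable_mul hu
  rw [h1, integral_hornMeasure hc hpos hint]
  have h2 : ∀ x ∈ Set.Ioi (1 : ℝ), fiberIntegral f (fun p => (k p : ℂ) * u p) x =
      (Set.Ioc α β).indicator (fun x => ∫ t in γ..δ, u (x, f x * t)) x := by
    intro x hx
    have hfx := (hpos x hx).ne'
    by_cases hI : x ∈ Set.Ioc α β
    · have h3 : ∀ t, (k (x, f x * t) : ℂ) * u (x, f x * t) =
          (f x)⁻¹ • (Set.Ioc γ δ).indicator (fun t => u (x, f x * t)) t := by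
        intro t
        simp only [k]
        rw [mul_div_cancel_left₀ _ hfx]
        by_cases ht : t ∈ Set.Ioc γ δ
        · rw [Set.indicator_of_mem (show (x, t) ∈ Set.Ioc α β ×ˢ Set.Ioc γ δ from ⟨hI, ht⟩),
            Set.indicator_of_mem ht, one_mul, Complex.real_smul]
        · rw [Set.indicator_of_notMem (fun h : (x, t) ∈ Set.Ioc α β ×ˢ Set.Ioc γ δ => ht h.2),
            Set.indicator_of_notMem ht]
          simp
      rw [Set.indicator_of_mem hI, fiberIntegral]
      simp only [h3]
      rw [intervalIntegral.integral_smul, smul_inv_smul₀ hfx,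
        intervalIntegral.integral_of_le (by norm_num), setIntegral_indicator measurableSet_Ioc,
        Set.inter_eq_right.2 (Set.Ioc_subset_Ioc hγ hδ), intervalIntegral.integral_of_le hγδ]
    · have h3 : ∀ t, (k (x, f x * t) : ℂ) * u (x, f x * t) = 0 := by
        intro t
        simp only [k]
        rw [Set.indicator_of_notMem (fun h => hI h.1)]
        simp
      rw [Set.indicator_of_notMem hI, fiberIntegral]
      simp only [h3]
      simp
  rw [setIntegral_congr_fun measurableSet_Ioi h2, setIntegral_indicator measurableSet_Ioc,
    Set.inter_eq_right.2 ?_, intervalIntegral.integral_of_le hαβ]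
  exact fun x hx => hα.trans_lt hx.1

end Functionals

/-! ### The estimate on the truncated horn -/

section Body

variable {f : ℝ → ℝ}

/-- The pullback `w(x, t) = u(x, f x * t)` has `w_x = u_x + f' t u_y` and `w_t = f u_y`. With `c ≤ f
≤ M` and `|f'| ≤ L` its norms on the rectangle are controlled by those of `u` on the horn and
conversely, as far as needed to transfer the rectangle inequality. -/
theorem exists_integral_body_le (hf : IsCuspProfile f) (hreg : IsRegularAtOne f) {R ε : ℝ}
    (hR : 1 < R) (hε : 0 < ε) :
    ∃ (s : Finset (ℕ × ℕ)) (g : ℕ × ℕ → Lp ℂ 2 (hornMeasure f)) (C : ℝ),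
      ∀ (u : ℝ × ℝ → ℂ) (_ : ContDiff ℝ 1 u) (hu2 : MemLp u 2 (hornMeasure f))
        (_ : MemLp (partialX u) 2 (hornMeasure f)) (_ : MemLp (partialY u) 2 (hornMeasure f)),
        ∫ x in (1 : ℝ)..R, fiberIntegral f (fun p => ‖u p‖ ^ 2) x ≤
          ε * (∫ x in (1 : ℝ)..R,
            fiberIntegral f (fun p => ‖partialX u p‖ ^ 2 + ‖partialY u p‖ ^ 2) x) +
          C * ∑ i ∈ s, ‖inner ℂ (g i) (hu2.toLp u)‖ ^ 2 := by
  obtain ⟨c, M, L, hc, hM, hL, hb⟩ := hf.exists_bounds hreg R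
  have hpos := hf.pos
  -- The numerator bounds `|w_x|² + |w_t|²` by `|∇u|²`; division by `c` pays for the Jacobian `f ≥
  -- c` contained in `fiberIntegral`.
  set A := (2 + 2 * L ^ 2 + M ^ 2) / c with hA
  have hA0 : 0 < A := by positivity
  obtain ⟨n, m, C, a, d, hC, ha, hd, h⟩ :=
    -- `M` is lost in passing from the slice norm of `u` to that of `w`, and `A` in returning from
    -- the gradient of `w` to that of `u`.
    exists_partition_integral_rectangle_le hR (show 0 < ε / (M * A) by positivity)
  have hg : ∀ q : ℕ × ℕ, ∃ g : Lp ℂ 2 (hornMeasure f), q ∈ Finset.range m ×ˢ Finset.range n →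
      ∀ (u : ℝ × ℝ → ℂ) (hu : MemLp u 2 (hornMeasure f)), inner ℂ g (hu.toLp u) =
        ∫ x in a q.2..a (q.2 + 1), ∫ t in d q.1..d (q.1 + 1), u (x, f x * t) := by
    intro q
    by_cases hq : q ∈ Finset.range m ×ˢ Finset.range n
    · rw [Finset.mem_product, Finset.mem_range, Finset.mem_range] at hq
      obtain ⟨h1, h2, h3⟩ := ha q.2 hq.2
      obtain ⟨h4, h5, h6⟩ := hd q.1 hq.1
      obtain ⟨g, hg⟩ := exists_inner_eq_integral_rectangle hf.continuousOn hpos (R := R) (M := M) hc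
        (fun x hx => ⟨(hb x hx).1, (hb x hx).2.1⟩) h1 h2.le h3 h4 h5.le h6
      exact ⟨g, fun _ => hg⟩
    · exact ⟨0, fun h => absurd h hq⟩
  choose g hg using hg
  refine ⟨Finset.range m ×ˢ Finset.range n, g, M * C, fun u hu hu2 huX huY => ?_⟩
  let w : ℝ → ℝ → ℂ := fun x t => u (x, f x * t)
  let wx : ℝ → ℝ → ℂ := fun x t =>
    partialX u (x, f x * t) + (deriv f x * t : ℝ) • partialY u (x, f x * t)
  let wt : ℝ → ℝ → ℂ := fun x t => f x • partialY u (x, f x * t)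
  have hcX := continuous_partialX hu
  have hcY := continuous_partialY hu
  have cw := continuousOn_comp_fiber hf.continuousOn hu.continuous
  have cX := continuousOn_comp_fiber hf.continuousOn hcX
  have cY := continuousOn_comp_fiber hf.continuousOn hcY
  have cf : ContinuousOn (fun p : ℝ × ℝ => f p.1) (Set.Ioi 1 ×ˢ Set.univ) :=
    hf.continuousOn.comp continuousOn_fst fun p hp => hp.1
  have cf' : ContinuousOn (fun p : ℝ × ℝ => deriv f p.1) (Set.Ioi 1 ×ˢ Set.univ) :=
    hf.continuousOn_deriv.comp continuousOn_fst fun p hp => hp.1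
  have cwx : ContinuousOn (Function.uncurry wx) (Set.Ioi 1 ×ˢ Set.univ) :=
    cX.add ((cf'.mul continuousOn_snd).smul cY)
  have cwt : ContinuousOn (Function.uncurry wt) (Set.Ioi 1 ×ˢ Set.univ) := cf.smul cY
  -- bounds on the compact box containing the truncated horn
  have hbox : IsCompact (Set.Icc 1 R ×ˢ Set.Icc (-M) M) := isCompact_Icc.prod isCompact_Icc
  obtain ⟨B0, hB0⟩ := hbox.exists_bound_of_continuousOn hu.continuous.continuousOn
  obtain ⟨B1, hB1⟩ := hbox.exists_bound_of_continuousOn hcX.continuousOn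
  obtain ⟨B2, hB2⟩ := hbox.exists_bound_of_continuousOn hcY.continuousOn
  have hmem : ∀ x ∈ Set.Ioo 1 R, ∀ t ∈ Set.Icc (-1 : ℝ) 1,
      (x, f x * t) ∈ Set.Icc 1 R ×ˢ Set.Icc (-M) M := by
    intro x hx t ht
    refine ⟨⟨hx.1.le, hx.2.le⟩, abs_le.1 ?_⟩
    rw [abs_mul, abs_of_pos (hpos x hx.1)]
    have := (hb x ⟨hx.1, hx.2.le⟩).2.1
    exact (mul_le_mul this (abs_le.2 ht) (abs_nonneg _) hM.le).trans (mul_one M).le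
  have hone : (1, (0 : ℝ)) ∈ Set.Icc 1 R ×ˢ Set.Icc (-M) M :=
    ⟨⟨le_rfl, hR.le⟩, by constructor <;> linarith⟩
  have hB20 : 0 ≤ B2 := (norm_nonneg _).trans (hB2 _ hone)
  have key := h w wx wt (max B0 (max (B1 + L * B2) (M * B2))) cw cwx cwt
    (fun x hx t => hasDerivAt_comp_fiber hu (hf.differentiableAt hx).hasDerivAt t)
    (fun x hx t => hasDerivAt_comp_mul hu x (f x) t) (by
      intro x hx t ht
      have hp := hmem x hx t ht
      obtain ⟨h1, h2, h3⟩ := hb x ⟨hx.1, hx.2.le⟩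
      refine ⟨(hB0 _ hp).trans (le_max_left _ _), le_trans ?_ ((le_max_left _ _).trans
        (le_max_right _ _)), le_trans ?_ ((le_max_right _ _).trans (le_max_right _ _))⟩
      · refine (norm_add_le _ _).trans (add_le_add (hB1 _ hp) ?_)
        rw [norm_smul, Real.norm_eq_abs, abs_mul]
        have : |deriv f x| * |t| ≤ L :=
          (mul_le_mul h3 (abs_le.2 ht) (abs_nonneg _) hL).trans (mul_one L).le
        exact mul_le_mul this (hB2 _ hp) (norm_nonneg _) hL
      · rw [norm_smul, Real.norm_of_nonneg (hpos x hx.1).le]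
        exact mul_le_mul h2 (hB2 _ hp) (norm_nonneg _) hM.le)
  have iN : IntervalIntegrable (fiberIntegral f fun p => ‖u p‖ ^ 2) volume 1 R :=
    (intervalIntegrable_iff_integrableOn_Ioc_of_le hR.le).2
      ((integrableOn_fiberIntegral hf.continuousOn hpos hu2.norm.integrable_sq).mono_set
        Set.Ioc_subset_Ioi_self)
  have iD : IntervalIntegrable
      (fiberIntegral f fun p => ‖partialX u p‖ ^ 2 + ‖partialY u p‖ ^ 2) volume 1 R :=
    (intervalIntegrable_iff_integrableOn_Ioc_of_le hR.le).2
      ((integrableOn_fiberIntegral hf.continuousOn hpos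
        (huX.norm.integrable_sq.add huY.norm.integrable_sq)).mono_set Set.Ioc_subset_Ioi_self)
  have hm1 : (-1 : ℝ) ≤ 1 := by norm_num
  have iw : IntervalIntegrable (fun x => ∫ t in (-1 : ℝ)..1, ‖w x t‖ ^ 2) volume 1 R := by
    refine intervalIntegrable_intervalIntegral_param (F := fun x t => ‖w x t‖ ^ 2) (B := B0 ^ 2)
      hR.le le_rfl hm1 le_rfl ((cw.norm.pow 2).congr fun _ _ => rfl) fun x hx t ht => ?_
    rw [Real.norm_of_nonneg (by positivity)]
    exact pow_le_pow_left₀ (norm_nonneg _) (hB0 _ (hmem x hx t ht)) 2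
  have hN : ∫ x in (1 : ℝ)..R, fiberIntegral f (fun p => ‖u p‖ ^ 2) x ≤
      M * ∫ x in (1 : ℝ)..R, ∫ t in (-1 : ℝ)..1, ‖w x t‖ ^ 2 := by
    rw [← intervalIntegral.integral_const_mul]
    refine intervalIntegral.integral_mono_on_of_le_Ioo hR.le iN (iw.const_mul M) fun x hx => ?_
    exact mul_le_mul_of_nonneg_right (hb x ⟨hx.1, hx.2.le⟩).2.1
      (intervalIntegral.integral_nonneg hm1 fun _ _ => by positivity)
  have hD : ∀ x ∈ Set.Ioo 1 R, ∫ t in (-1 : ℝ)..1, (‖wx x t‖ ^ 2 + ‖wt x t‖ ^ 2) ≤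
      A * fiberIntegral f (fun p => ‖partialX u p‖ ^ 2 + ‖partialY u p‖ ^ 2) x := by
    intro x hx
    obtain ⟨h1, h2, h3⟩ := hb x ⟨hx.1, hx.2.le⟩
    have hfx := hpos x hx.1
    have hcx := continuous_of_continuousOn_prod_univ cwx (show x ∈ Set.Ioi 1 from hx.1)
    have hct := continuous_of_continuousOn_prod_univ cwt (show x ∈ Set.Ioi 1 from hx.1)
    have hcD : Continuous fun t => ‖partialX u (x, f x * t)‖ ^ 2 +
        ‖partialY u (x, f x * t)‖ ^ 2 := by fun_prop
    have hcD0 : 0 ≤ ∫ t in (-1 : ℝ)..1, (‖partialX u (x, f x * t)‖ ^ 2 +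
        ‖partialY u (x, f x * t)‖ ^ 2) :=
      intervalIntegral.integral_nonneg hm1 fun _ _ => by positivity
    calc ∫ t in (-1 : ℝ)..1, (‖wx x t‖ ^ 2 + ‖wt x t‖ ^ 2)
        ≤ ∫ t in (-1 : ℝ)..1, (2 + 2 * L ^ 2 + M ^ 2) * (‖partialX u (x, f x * t)‖ ^ 2 +
          ‖partialY u (x, f x * t)‖ ^ 2) := by
          refine intervalIntegral.integral_mono_on hm1
            (((hcx.norm.pow 2).add (hct.norm.pow 2)).intervalIntegrable _ _)
            ((hcD.const_mul _).intervalIntegrable _ _) fun t ht => ?_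
          set z1 := ‖partialX u (x, f x * t)‖
          set z2 := ‖partialY u (x, f x * t)‖ with hz2
          have hz20 : 0 ≤ z2 := norm_nonneg _
          have e1 : ‖wx x t‖ ≤ z1 + L * z2 := by
            refine (norm_add_le _ _).trans (add_le_add le_rfl ?_)
            rw [norm_smul, Real.norm_eq_abs, abs_mul]
            have : |deriv f x| * |t| ≤ L :=
              (mul_le_mul h3 (abs_le.2 ht) (abs_nonneg _) hL).trans (mul_one L).le
            exact mul_le_mul_of_nonneg_right this hz20
          have e2 : ‖wt x t‖ ≤ M * z2 := by
            rw [norm_smul, Real.norm_of_nonneg hfx.le]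
            exact mul_le_mul_of_nonneg_right h2 hz20
          have e3 := pow_le_pow_left₀ (norm_nonneg _) e1 2
          have e4 := pow_le_pow_left₀ (norm_nonneg _) e2 2
          nlinarith [sq_nonneg (z1 - L * z2), sq_nonneg z1, sq_nonneg z2,
            mul_nonneg (sq_nonneg L) (sq_nonneg z1), mul_nonneg (sq_nonneg M) (sq_nonneg z1)]
      _ = (2 + 2 * L ^ 2 + M ^ 2) * ∫ t in (-1 : ℝ)..1, (‖partialX u (x, f x * t)‖ ^ 2 +
          ‖partialY u (x, f x * t)‖ ^ 2) := intervalIntegral.integral_const_mul _ _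
      _ ≤ A * fiberIntegral f (fun p => ‖partialX u p‖ ^ 2 + ‖partialY u p‖ ^ 2) x := by
          rw [fiberIntegral, hA, smul_eq_mul, ← mul_assoc]
          refine mul_le_mul_of_nonneg_right ?_ hcD0
          rw [div_mul_eq_mul_div, le_div_iff₀ hc]
          gcongr
  have hDi : ∫ x in (1 : ℝ)..R, ∫ t in (-1 : ℝ)..1, (‖wx x t‖ ^ 2 + ‖wt x t‖ ^ 2) ≤
      A * ∫ x in (1 : ℝ)..R,
        fiberIntegral f (fun p => ‖partialX u p‖ ^ 2 + ‖partialY u p‖ ^ 2) x := by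
    rw [← intervalIntegral.integral_const_mul]
    refine intervalIntegral.integral_mono_on_of_le_Ioo hR.le ?_ (iD.const_mul A) hD
    have hcont : ContinuousOn (fun x => ∫ t in (-1 : ℝ)..1, (‖wx x t‖ ^ 2 + ‖wt x t‖ ^ 2))
        (Set.Ioi 1) := continuousOn_intervalIntegral_param
      (F := fun x t => ‖wx x t‖ ^ 2 + ‖wt x t‖ ^ 2)
      (((cwx.norm.pow 2).add (cwt.norm.pow 2)).congr fun _ _ => rfl) _ _
    refine (iD.const_mul A).mono_fun ?_ ?_
    · rw [Set.uIoc_of_le hR.le]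
      exact (hcont.mono Set.Ioc_subset_Ioi_self).aestronglyMeasurable measurableSet_Ioc
    · rw [Set.uIoc_of_le hR.le]
      have hae : ∀ᵐ x : ℝ, x ≠ R := by simp [ae_iff]
      refine (ae_restrict_iff' measurableSet_Ioc).2 ?_
      filter_upwards [hae] with x hxR hx
      have hx' : x ∈ Set.Ioo 1 R := ⟨hx.1, lt_of_le_of_ne hx.2 hxR⟩
      have h0 : 0 ≤ ∫ t in (-1 : ℝ)..1, (‖wx x t‖ ^ 2 + ‖wt x t‖ ^ 2) :=
        intervalIntegral.integral_nonneg hm1 fun _ _ => by positivity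
      rw [Real.norm_of_nonneg h0, Real.norm_of_nonneg (h0.trans (hD x hx'))]
      exact hD x hx'
  have hsum : ∑ i ∈ Finset.range m ×ˢ Finset.range n, ‖inner ℂ (g i) (hu2.toLp u)‖ ^ 2 =
      ∑ j ∈ Finset.range m, ∑ i ∈ Finset.range n,
        ‖∫ x in a i..a (i + 1), ∫ t in d j..d (j + 1), w x t‖ ^ 2 := by
    rw [← Finset.sum_product']
    exact Finset.sum_congr rfl fun q hq => by rw [hg q hq u hu2]
  rw [hsum]
  refine hN.trans ((mul_le_mul_of_nonneg_left key hM.le).trans ?_)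
  rw [mul_add, ← mul_assoc M C]
  refine add_le_add ?_ le_rfl
  refine (mul_le_mul_of_nonneg_left (mul_le_mul_of_nonneg_left hDi (by positivity)) hM.le).trans
    (le_of_eq ?_)
  field_simp

end Body

/-! ### Integration against `σ(x) dx` -/

section BoundaryMeasure

variable {σ : ℝ → ℝ} {G : Type*} [NormedAddCommGroup G] [NormedSpace ℝ G]

theorem aemeasurable_ofReal_restrict_Ioi (hσ : ContinuousOn σ (Set.Ioi 1)) :
    AEMeasurable (fun x => ENNReal.ofReal (σ x)) (volume.restrict (Set.Ioi 1)) :=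
  (hσ.aemeasurable measurableSet_Ioi).ennreal_ofReal

theorem integrable_boundaryMeasure_iff (hσ : ContinuousOn σ (Set.Ioi 1)) (h0 : ∀ x > 1, 0 ≤ σ x)
    {g : ℝ → G} :
    Integrable g (boundaryMeasure σ) ↔ IntegrableOn (fun x => σ x • g x) (Set.Ioi 1) := by
  rw [boundaryMeasure, integrable_withDensity_iff_integrable_smul₀'
    (aemeasurable_ofReal_restrict_Ioi hσ) (by simp), IntegrableOn]
  refine integrable_congr ((ae_restrict_iff' measurableSet_Ioi).2 (Eventually.of_forall ?_))
  intro x hx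
  simp only [ENNReal.toReal_ofReal (h0 x hx)]

theorem integral_boundaryMeasure (hσ : ContinuousOn σ (Set.Ioi 1)) (h0 : ∀ x > 1, 0 ≤ σ x)
    (g : ℝ → G) :
    ∫ x, g x ∂(boundaryMeasure σ) = ∫ x in Set.Ioi 1, σ x • g x := by
  rw [boundaryMeasure, integral_withDensity_eq_integral_toReal_smul₀
    (aemeasurable_ofReal_restrict_Ioi hσ) (by simp)]
  refine setIntegral_congr_fun measurableSet_Ioi fun x hx => ?_
  simp only [ENNReal.toReal_ofReal (h0 x hx)]

end BoundaryMeasure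

/-! ### The estimate far out in the horn -/

section Tail

variable {f σ : ℝ → ℝ} {u : ℝ × ℝ → ℂ}

/-- The sum of the squares of `u` at the two boundary points of the horn over `x`. -/
noncomputable def traceSq (f : ℝ → ℝ) (u : ℝ × ℝ → ℂ) (x : ℝ) : ℝ :=
  ‖u (x, f x)‖ ^ 2 + ‖u (x, -f x)‖ ^ 2

theorem traceSq_nonneg (f : ℝ → ℝ) (u : ℝ × ℝ → ℂ) (x : ℝ) : 0 ≤ traceSq f u x := by
  unfold traceSq; positivity

/-- The integrand is the derivative of `t ‖u (x, f x * t)‖²`; the weight `t` equals `±1` at the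
ends, so both traces appear with a plus sign. -/
theorem traceSq_eq_integral (hu : ContDiff ℝ 1 u) (x : ℝ) :
    traceSq f u x = ∫ t in (-1 : ℝ)..1, (‖u (x, f x * t)‖ ^ 2 +
      t * (2 * (f x * inner ℝ (u (x, f x * t)) (partialY u (x, f x * t))))) := by
  have hcY := continuous_partialY hu
  have hc := hu.continuous
  have hd : ∀ t ∈ Set.uIcc (-1 : ℝ) 1, HasDerivAt (fun t => t * ‖u (x, f x * t)‖ ^ 2)
      (‖u (x, f x * t)‖ ^ 2 +
      t * (2 * (f x * inner ℝ (u (x, f x * t)) (partialY u (x, f x * t))))) t := by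
    intro t _
    have h := (hasDerivAt_id t).mul (hasDerivAt_comp_mul hu x (f x) t).norm_sq
    refine h.congr_deriv ?_
    rw [real_inner_smul_right, one_mul]
    rfl
  have hcont : Continuous fun t => (‖u (x, f x * t)‖ ^ 2 +
      t * (2 * (f x * inner ℝ (u (x, f x * t)) (partialY u (x, f x * t))))) := by fun_prop
  rw [intervalIntegral.integral_eq_sub_of_hasDerivAt hd (hcont.intervalIntegrable _ _)]
  simp [traceSq]

theorem hasDerivAt_fiberIntegral_norm_sq (hf : IsCuspProfile f) (hu : ContDiff ℝ 1 u) {x : ℝ}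
    (hx : 1 < x) :
    HasDerivAt (fiberIntegral f fun p => ‖u p‖ ^ 2)
      (deriv f x * (∫ t in (-1 : ℝ)..1, ‖u (x, f x * t)‖ ^ 2) +
        f x * ∫ t in (-1 : ℝ)..1, 2 * inner ℝ (u (x, f x * t))
          (partialX u (x, f x * t) + (deriv f x * t : ℝ) • partialY u (x, f x * t))) x := by
  have cw := continuousOn_comp_fiber hf.continuousOn hu.continuous
  have cX := continuousOn_comp_fiber hf.continuousOn (continuous_partialX hu)
  have cY := continuousOn_comp_fiber hf.continuousOn (continuous_partialY hu)
  have cf' : ContinuousOn (fun p : ℝ × ℝ => deriv f p.1) (Set.Ioi 1 ×ˢ Set.univ) :=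
    hf.continuousOn_deriv.comp continuousOn_fst fun p hp => hp.1
  have h := hasDerivAt_intervalIntegral_param (F := fun x t => ‖u (x, f x * t)‖ ^ 2)
    (F' := fun x t => 2 * inner ℝ (u (x, f x * t))
          (partialX u (x, f x * t) + (deriv f x * t : ℝ) • partialY u (x, f x * t)))
    isOpen_Ioi ((cw.norm.pow 2).congr fun _ _ => rfl)
    ((continuousOn_const.mul (cw.inner (𝕜 := ℝ)
      (cX.add ((cf'.mul continuousOn_snd).smul cY)))).congr fun _ _ => rfl)
    (fun x hx t =>
      (hasDerivAt_comp_fiber hu (hf.differentiableAt hx).hasDerivAt t).norm_sq) hx (-1) 1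
  exact (hf.differentiableAt hx).hasDerivAt.mul h

/-- Write `w`, `wx`, `wy` for `u` and its partial derivatives at `(x, f x * t)`. With `b = s + a f'`
the right side is `∫ (b |w|² + 2 f (a ⟪w, wx⟫ + b t ⟪w, wy⟫)) dt`, whose first term is `(b / f) N`,
with `N` the slice integral of `|u|²`. The cross terms are bounded below by `|a w + wx|² + |b t w +
wy|² ≥ 0` and `t² ≤ 1`. -/
theorem fiberIntegral_lower_bound (hf : IsCuspProfile f) (hu : ContDiff ℝ 1 u) {x : ℝ}
    (hx : 1 < x) (a b s : ℝ) (hb : b = s + a * deriv f x) :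
    (b / f x - a ^ 2 - b ^ 2) * fiberIntegral f (fun p => ‖u p‖ ^ 2) x -
      fiberIntegral f (fun p => ‖partialX u p‖ ^ 2 + ‖partialY u p‖ ^ 2) x ≤
    a * (deriv f x * (∫ t in (-1 : ℝ)..1, ‖u (x, f x * t)‖ ^ 2) +
        f x * ∫ t in (-1 : ℝ)..1, 2 * inner ℝ (u (x, f x * t))
          (partialX u (x, f x * t) + (deriv f x * t : ℝ) • partialY u (x, f x * t))) +
      s * traceSq f u x := by
  have hfx := hf.pos x hx
  have hc := hu.continuous
  have hcX := continuous_partialX hu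
  have hcY := continuous_partialY hu
  have c0 : Continuous fun t : ℝ => ‖u (x, f x * t)‖ ^ 2 := by fun_prop
  have cD : Continuous fun t : ℝ => ‖partialX u (x, f x * t)‖ ^ 2 +
    ‖partialY u (x, f x * t)‖ ^ 2 := by fun_prop
  have c1 : Continuous fun t : ℝ => 2 * inner ℝ (u (x, f x * t))
    (partialX u (x, f x * t) + (deriv f x * t : ℝ) • partialY u (x, f x * t)) := by fun_prop
  have c2 : Continuous fun t => (‖u (x, f x * t)‖ ^ 2 +
    t * (2 * (f x * inner ℝ (u (x, f x * t)) (partialY u (x, f x * t))))) := by fun_prop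
  rw [traceSq_eq_integral hu, fiberIntegral, fiberIntegral, smul_eq_mul, smul_eq_mul]
  have i0 := c0.intervalIntegrable (μ := volume) (-1) 1
  have iD := cD.intervalIntegrable (μ := volume) (-1) 1
  have i1 := c1.intervalIntegrable (μ := volume) (-1) 1
  have i2 := c2.intervalIntegrable (μ := volume) (-1) 1
  have key := intervalIntegral.integral_mono_on (show (-1 : ℝ) ≤ 1 by norm_num)
    ((i0.const_mul ((b / f x - a ^ 2 - b ^ 2) * f x)).sub (iD.const_mul (f x)))
    (((i0.const_mul (a * deriv f x)).add (i1.const_mul (a * f x))).add (i2.const_mul s))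
    (fun t ht => ?_)
  · rw [intervalIntegral.integral_sub (i0.const_mul _) (iD.const_mul _),
      intervalIntegral.integral_add ((i0.const_mul _).add (i1.const_mul _)) (i2.const_mul _),
      intervalIntegral.integral_add (i0.const_mul _) (i1.const_mul _)] at key
    simp only [intervalIntegral.integral_const_mul] at key ⊢
    linarith
  · have ht2 : t ^ 2 ≤ 1 := by nlinarith [ht.1, ht.2]
    set w := u (x, f x * t)
    set wx := partialX u (x, f x * t)
    set wy := partialY u (x, f x * t)
    have e1 : 0 ≤ ‖a • w + wx‖ ^ 2 := by positivity
    have e2 : 0 ≤ ‖(b * t) • w + wy‖ ^ 2 := by positivity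
    rw [norm_add_sq_real, norm_smul, inner_smul_left, mul_pow, Real.norm_eq_abs, sq_abs] at e1 e2
    have e3 : (b * t) ^ 2 * ‖w‖ ^ 2 ≤ b ^ 2 * ‖w‖ ^ 2 := by
      rw [mul_pow]
      exact mul_le_mul_of_nonneg_right (mul_le_of_le_one_right (sq_nonneg b) ht2) (sq_nonneg _)
    have e4 : (b / f x - a ^ 2 - b ^ 2) * f x = b - (a ^ 2 + b ^ 2) * f x := by
      field_simp
      ring
    rw [e4, inner_add_right, inner_smul_right]
    simp only [conj_trivial] at e1 e2
    have e5 : 0 ≤ f x * (a ^ 2 * ‖w‖ ^ 2 + 2 * (a * inner ℝ w wx) + ‖wx‖ ^ 2 +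
        (b ^ 2 * ‖w‖ ^ 2 + 2 * (b * t * inner ℝ w wy) + ‖wy‖ ^ 2)) :=
      mul_nonneg hfx.le (by linarith)
    have e6 : b * ‖w‖ ^ 2 = s * ‖w‖ ^ 2 + a * deriv f x * ‖w‖ ^ 2 := by rw [hb]; ring
    have e7 : f x * (2 * (b * t * inner ℝ w wy)) =
      f x * (2 * (s * t * inner ℝ w wy)) + f x * (2 * (a * deriv f x * t * inner ℝ w wy)) := by
      rw [hb]; ring
    linarith

/-- A positive decreasing function with second derivative at most one satisfies `f'² ≤ 2 f`. -/
theorem IsCuspProfile.eventually_deriv_sq_le (hf : IsCuspProfile f) :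
    ∀ᶠ x in atTop, deriv f x ^ 2 ≤ 2 * f x := by
  have h2 : ∀ᶠ x in atTop, deriv (deriv f) x < 1 := hf.tendsto_deriv2.eventually_lt_const one_pos
  obtain ⟨X, hX⟩ := eventually_atTop.1 (h2.and (hf.deriv_nonpos.and (eventually_gt_atTop 1)))
  filter_upwards [eventually_ge_atTop X] with x hx
  have h1 : ∀ y, x ≤ y → 1 < y := fun y hy => (hX y (hx.trans hy)).2.2
  -- Taylor with `f'' ≤ 1` and step `h = -f'(x)` gives `0 < f (x + h) ≤ f x - h² / 2`.
  set h := -deriv f x with hh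
  have hh0 : 0 ≤ h := by have := (hX x hx).2.1; linarith
  have hd' : ∀ y, x ≤ y → HasDerivAt (deriv f) (deriv (deriv f) y) y := fun y hy =>
    ((hf.contDiffOn_deriv.contDiffAt (Ioi_mem_nhds (h1 y hy))).differentiableAt
      (by simp)).hasDerivAt
  have hstep1 : ∀ y, x ≤ y → deriv f y ≤ deriv f x + (y - x) := by
    intro y hy
    have := (convex_Icc x y).image_sub_le_mul_sub_of_deriv_le (f := deriv f) (C := 1)
      (fun z hz => (hd' z hz.1).continuousAt.continuousWithinAt)
      (fun z hz => (hd' z (interior_subset hz).1).differentiableAt.differentiableWithinAt)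
      (fun z hz => (hX z (hx.trans (interior_subset hz).1)).1.le) x (Set.left_mem_Icc.2 hy) y
      (Set.right_mem_Icc.2 hy) hy
    linarith
  have hk : ∀ z, x ≤ z → HasDerivAt (fun z => f z - deriv f x * (z - x) - (z - x) ^ 2 / 2)
      (deriv f z - deriv f x - (z - x)) z := by
    intro z hz
    have e1 := (hf.differentiableAt (h1 z hz)).hasDerivAt
    have e2 := ((hasDerivAt_id z).sub_const x)
    have e3 := (e1.sub (e2.const_mul (deriv f x))).sub ((e2.pow 2).div_const 2)
    refine e3.congr_deriv ?_
    simp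
  have hanti := antitoneOn_of_deriv_nonpos (convex_Icc x (x + h))
    (f := fun z => f z - deriv f x * (z - x) - (z - x) ^ 2 / 2)
    (fun z hz => (hk z hz.1).continuousAt.continuousWithinAt)
    (fun z hz => (hk z (interior_subset hz).1).differentiableAt.differentiableWithinAt)
    (fun z hz => by
      rw [(hk z (interior_subset hz).1).deriv]
      linarith [hstep1 z (interior_subset hz).1])
  have := hanti (Set.left_mem_Icc.2 (by linarith)) (Set.right_mem_Icc.2 (by linarith))
    (by linarith : x ≤ x + h)
  have hp := hf.pos (x + h) (h1 _ (by linarith))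
  simp only [sub_self, add_sub_cancel_left] at this
  rw [hh] at this
  rw [hh] at hp
  nlinarith

theorem intervalIntegral_le_setIntegral_Ioi {h : ℝ → ℝ} (hi : IntegrableOn h (Set.Ioi 1))
    (h0 : ∀ x > 1, 0 ≤ h x) {a b : ℝ} (ha : 1 ≤ a) (hab : a ≤ b) :
    ∫ x in a..b, h x ≤ ∫ x in Set.Ioi 1, h x := by
  rw [intervalIntegral.integral_of_le hab]
  refine setIntegral_mono_set hi ((ae_restrict_iff' measurableSet_Ioi).2 (Eventually.of_forall h0))
    (LE.le.eventuallyLE ?_)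
  exact fun x hx => ha.trans_lt hx.1

/-- The part of the `L²` norm far out in the horn is controlled by the form. -/
theorem exists_integral_tail_le (hf : IsCuspProfile f) (hσ : IsRobinCoefficient f σ) :
    ∃ K : ℝ, 0 ≤ K ∧ ∀ M : ℝ, 0 ≤ M → ∃ R > 1, ∀ u : ℝ × ℝ → ℂ, ContDiff ℝ 1 u →
      IntegrableOn (fiberIntegral f fun p => ‖u p‖ ^ 2) (Set.Ioi 1) →
      IntegrableOn (fiberIntegral f fun p => ‖partialX u p‖ ^ 2 + ‖partialY u p‖ ^ 2) (Set.Ioi 1) →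
      IntegrableOn (fun x => σ x * traceSq f u x) (Set.Ioi 1) →
      M * ∫ x in Set.Ioi R, fiberIntegral f (fun p => ‖u p‖ ^ 2) x ≤
        (∫ x in Set.Ioi 1, fiberIntegral f (fun p => ‖partialX u p‖ ^ 2 + ‖partialY u p‖ ^ 2) x) +
        (∫ x in Set.Ioi 1, σ x * traceSq f u x) +
        K * ∫ x in Set.Ioi 1, fiberIntegral f (fun p => ‖u p‖ ^ 2) x := by
  obtain ⟨Cσ, hCσ⟩ := hσ.bounded
  -- Half the logarithmic derivative of `f`: the choice for which the zeroth-order terms of `(a N)'`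
  -- add up to `W_σ`, up to the bounded `b²`.
  set a : ℝ → ℝ := fun x => 1 / 2 * (deriv f x / f x) with ha
  -- A bound for `b²`, as `b = σ + f'² / (2 f) ≤ Cσ + 1` beyond `X`.
  set K₀ := (Cσ + 1) ^ 2 with hK₀
  obtain ⟨X, hX⟩ := eventually_atTop.1 (hf.eventually_deriv_sq_le.and (hf.deriv_nonpos.and
    ((eventually_gt_atTop 1).and (hσ.tendsto_W.eventually_ge_atTop K₀))))
  have hX1 : 1 < X := (hX X le_rfl).2.2.1
  have hgt : ∀ x, X ≤ x → 1 < x := fun x hx => hX1.trans_le hx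
  have hac : ContinuousOn a (Set.Ioi 1) :=
    continuousOn_const.mul (hf.continuousOn_deriv.div hf.continuousOn fun x hx => (hf.pos x hx).ne')
  have ha0 : ∀ x, X ≤ x → a x ≤ 0 := fun x hx =>
    mul_nonpos_of_nonneg_of_nonpos (by norm_num)
      (div_nonpos_of_nonpos_of_nonneg (hX x hx).2.1 (hf.pos x (hgt x hx)).le)
  have had : ∀ x, X ≤ x → HasDerivAt a (1 / 2 * deriv (fun t => deriv f t / f t) x) x := by
    intro x hx
    have h1 : DifferentiableAt ℝ (deriv f) x :=
      (hf.contDiffOn_deriv.contDiffAt (Ioi_mem_nhds (hgt x hx))).differentiableAt (by simp)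
    exact ((h1.div (hf.differentiableAt (hgt x hx))
      (hf.pos x (hgt x hx)).ne').hasDerivAt).const_mul _
  -- `K` depends only on `X`, not on `M`; this is what allows `M` to be chosen after `K`.
  obtain ⟨K, hK⟩ := (isCompact_Icc (a := X) (b := X + 1)).exists_bound_of_continuousOn
    (hac.mono fun x hx => hgt x hx.1)
  have hK0 : 0 ≤ K := (norm_nonneg _).trans (hK X ⟨le_rfl, by linarith⟩)
  refine ⟨K, hK0, fun M hM => ?_⟩
  obtain ⟨R, hR⟩ := eventually_atTop.1 ((eventually_ge_atTop (X + 1)).and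
    (hσ.tendsto_W.eventually_ge_atTop (M + K₀)))
  have hRX : X + 1 ≤ R := (hR R le_rfl).1
  refine ⟨R, by linarith, fun u hu iN iD iB => ?_⟩
  set N := fiberIntegral f fun p => ‖u p‖ ^ 2 with hN
  set D := fiberIntegral f fun p => ‖partialX u p‖ ^ 2 + ‖partialY u p‖ ^ 2 with hD
  have hN0 : ∀ x > 1, 0 ≤ N x := fun x hx =>
    fiberIntegral_nonneg hf.pos (fun p => by positivity) hx
  have hD0 : ∀ x > 1, 0 ≤ D x := fun x hx =>
    fiberIntegral_nonneg hf.pos (fun p => by positivity) hx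
  have hB0 : ∀ x > 1, 0 ≤ σ x * traceSq f u x := fun x hx =>
    mul_nonneg (hσ.nonneg x hx) (traceSq_nonneg f u x)
  have hNc : ContinuousOn N (Set.Ioi 1) :=
    continuousOn_fiberIntegral hf.continuousOn (hu.continuous.norm.pow 2)
  -- The lower limit of integration: at a minimum of `N` on an interval of length one, `N x₀` is at
  -- most `∫ N`, so the boundary term `-a x₀ * N x₀` is controlled by `K ‖u‖²`.
  obtain ⟨x₀, hx₀, hmin⟩ := (isCompact_Icc (a := X) (b := X + 1)).exists_isMinOn
    (Set.nonempty_Icc.2 (by linarith)) (hNc.mono fun x hx => hgt x hx.1)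
  have hNx₀ : N x₀ ≤ ∫ x in Set.Ioi 1, N x := by
    refine le_trans ?_ (intervalIntegral_le_setIntegral_Ioi iN hN0 hX1.le
      (show X ≤ X + 1 by linarith))
    have h := intervalIntegral.integral_mono_on (show X ≤ X + 1 by linarith)
      (intervalIntegrable_const (μ := volume) (c := N x₀))
      ((hNc.mono fun x hx => hgt x hx.1).intervalIntegrable_of_Icc (μ := volume) (by linarith))
      (fun x hx => hmin hx)
    simpa using h
  -- the derivative of `a N`
  have hderiv : ∀ x, X ≤ x → ∃ g', HasDerivAt (fun x => a x * N x) g' x ∧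
      (potentialW f σ x - K₀) * N x - D x - σ x * traceSq f u x ≤ g' := by
    intro x hx
    have hx1 := hgt x hx
    have hfx := hf.pos x hx1
    have hN' := hasDerivAt_fiberIntegral_norm_sq hf hu hx1
    refine ⟨_, (had x hx).mul hN', ?_⟩
    set b := σ x + a x * deriv f x with hb
    have hlow := fiberIntegral_lower_bound hf hu hx1 (a x) b (σ x) hb
    have hb1 : a x * deriv f x = deriv f x ^ 2 / (2 * f x) := by
      simp only [ha]; field_simp
    have hb2 : 0 ≤ b := by
      rw [hb, hb1]; exact add_nonneg (hσ.nonneg x hx1) (by positivity)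
    have hb3 : b ≤ Cσ + 1 := by
      rw [hb, hb1]
      refine add_le_add ((le_abs_self _).trans (hCσ x hx1).1) ?_
      rw [div_le_one (by positivity)]
      exact (hX x hx).1
    have hb4 : b ^ 2 ≤ K₀ := pow_le_pow_left₀ hb2 hb3 2
    -- `a f' / f = 2 a²`, so `a' + b / f - a² = a' + a² + σ / f = W_σ`.
    have hW : potentialW f σ x = 1 / 2 * deriv (fun t => deriv f t / f t) x + b / f x - a x ^ 2 := by
      rw [potentialW, potentialV, hb, ha]
      field_simp
      ring
    have hb5 : b ^ 2 * N x ≤ K₀ * N x := mul_le_mul_of_nonneg_right hb4 (hN0 x hx1)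
    rw [hW]
    change (b / f x - a x ^ 2 - b ^ 2) * N x - D x ≤ _ at hlow
    change _ ≤ 1 / 2 * deriv (fun t => deriv f t / f t) x * N x + _
    linarith
  choose! g' hg' hg'le using hderiv
  have iDB : IntegrableOn (fun x => D x + σ x * traceSq f u x) (Set.Ioi 1) := iD.add iB
  have hx₀1 : 1 < x₀ := hgt x₀ hx₀.1
  have hcont : ∀ p q, X ≤ p → ContinuousOn (fun x => a x * N x) (Set.Icc p q) := fun p q hp x hx =>
    (hg' x (hp.trans hx.1)).continuousAt.continuousWithinAt
  have hint1 : ∀ p q, X ≤ p → IntegrableOn (fun x => D x + σ x * traceSq f u x) (Set.Icc p q) :=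
    fun p q hp => iDB.mono_set fun x hx => hgt x (hp.trans hx.1)
  -- Between `x₀` and `R` only `W_σ ≥ K₀` is available, so the term in `N` is nonnegative and
  -- dropped. The one-sided fundamental theorem needs no integrability of `g'`.
  have step1 : -(∫ x in x₀..R, (D x + σ x * traceSq f u x)) ≤ a R * N R - a x₀ * N x₀ := by
    rw [← intervalIntegral.integral_neg]
    refine intervalIntegral.integral_le_sub_of_hasDeriv_right_of_le (hx₀.2.trans hRX)
      (hcont _ _ hx₀.1) (fun x hx => (hg' x (hx₀.1.trans hx.1.le)).hasDerivWithinAt)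
      (hint1 _ _ hx₀.1).neg fun x hx => ?_
    have hxX : X ≤ x := hx₀.1.trans hx.1.le
    have h1 := hg'le x hxX
    have h2 : 0 ≤ (potentialW f σ x - K₀) * N x :=
      mul_nonneg (sub_nonneg.2 (hX x hxX).2.2.2) (hN0 x (hgt x hxX))
    linarith
  have hXR : X ≤ R := by linarith
  have step2 : ∀ R', R ≤ R' → M * ∫ x in R..R', N x ≤
      (∫ x in Set.Ioi 1, D x) + (∫ x in Set.Ioi 1, σ x * traceSq f u x) +
        K * ∫ x in Set.Ioi 1, N x := by
    intro R' hRR'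
    have iN' : IntervalIntegrable N volume R R' :=
      (intervalIntegrable_iff_integrableOn_Icc_of_le hRR').2
        (iN.mono_set fun x hx => hgt x (hXR.trans hx.1))
    have iDB' : ∀ p q, X ≤ p → p ≤ q →
        IntervalIntegrable (fun x => D x + σ x * traceSq f u x) volume p q := fun p q hp hpq =>
      (intervalIntegrable_iff_integrableOn_Icc_of_le hpq).2 (hint1 p q hp)
    have h1 : ∫ x in R..R', (M * N x - (D x + σ x * traceSq f u x)) ≤
        a R' * N R' - a R * N R := by
      refine intervalIntegral.integral_le_sub_of_hasDeriv_right_of_le hRR'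
        (hcont _ _ hXR) (fun x hx => (hg' x (hXR.trans hx.1.le)).hasDerivWithinAt)
        (((iN.mono_set fun x hx => hgt x (hXR.trans hx.1)).const_mul M).sub (hint1 _ _ hXR))
        fun x hx => ?_
      have hxX : X ≤ x := hXR.trans hx.1.le
      have h1 := hg'le x hxX
      have h2 : M * N x ≤ (potentialW f σ x - K₀) * N x :=
        mul_le_mul_of_nonneg_right (by linarith [(hR x hx.1.le).2]) (hN0 x (hgt x hxX))
      linarith
    rw [intervalIntegral.integral_sub (iN'.const_mul M) (iDB' _ _ hXR hRR'),
      intervalIntegral.integral_const_mul] at h1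
    have h2 := intervalIntegral.integral_add_adjacent_intervals
      (iDB' x₀ R hx₀.1 (hx₀.2.trans hRX)) (iDB' R R' hXR hRR')
    have h3 : ∫ x in x₀..R', (D x + σ x * traceSq f u x) ≤
        ∫ x in Set.Ioi 1, (D x + σ x * traceSq f u x) :=
      intervalIntegral_le_setIntegral_Ioi iDB (fun x hx => add_nonneg (hD0 x hx) (hB0 x hx))
        hx₀1.le ((hx₀.2.trans hRX).trans hRR')
    rw [integral_add iD iB] at h3
    -- The boundary term at the far end has the favourable sign because `f' ≤ 0`.
    have h4 : a R' * N R' ≤ 0 := mul_nonpos_of_nonpos_of_nonneg (ha0 R' (hXR.trans hRR'))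
      (hN0 R' (hgt R' (hXR.trans hRR')))
    have h5 : -(a x₀ * N x₀) ≤ K * ∫ x in Set.Ioi 1, N x := by
      rw [← neg_mul]
      refine mul_le_mul ((neg_le_abs _).trans (hK x₀ hx₀)) hNx₀ (hN0 x₀ hx₀1) hK0
    linarith
  have hlim := (intervalIntegral_tendsto_integral_Ioi (μ := volume) R
    (iN.mono_set (Set.Ioi_subset_Ioi (by linarith))) tendsto_id).const_mul M
  exact le_of_tendsto hlim ((eventually_ge_atTop R).mono step2)

end Tail

/-! ### Inner products and norms of classes in `L²` -/

section L2

variable {α : Type*} [MeasurableSpace α] {μ : Measure α}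

theorem inner_toLp_toLp {g h : α → ℂ} (hg : MemLp g 2 μ) (hh : MemLp h 2 μ) :
    inner ℂ (hg.toLp g) (hh.toLp h) = ∫ x, conj (g x) * h x ∂μ := by
  rw [L2.inner_def]
  refine integral_congr_ae ?_
  filter_upwards [hg.coeFn_toLp, hh.coeFn_toLp] with p h1 h2
  rw [h1, h2]
  simp [mul_comm]

theorem norm_toLp_sq {g : α → ℂ} (hg : MemLp g 2 μ) :
    ‖hg.toLp g‖ ^ 2 = ∫ x, ‖g x‖ ^ 2 ∂μ := by
  have h := inner_toLp_toLp hg hg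
  rw [inner_self_eq_norm_sq_to_K] at h
  have e : ∀ x, conj (g x) * g x = ((‖g x‖ ^ 2 : ℝ) : ℂ) := fun x => by
    rw [← Complex.normSq_eq_conj_mul_self, Complex.normSq_eq_norm_sq]
  simp only [e] at h
  rw [integral_complex_ofReal] at h
  refine Complex.ofReal_injective ?_
  rw [← h, Complex.ofReal_pow]
  rfl

end L2

/-! ### Closability of derivatives and traces -/

section Closability

variable {f σ : ℝ → ℝ}

theorem setIntegral_hornMeasure_eq {G : Type*} [NormedAddCommGroup G] [NormedSpace ℝ G]
    {g : ℝ × ℝ → G} (hg : ∀ p ∉ hornDomain f, g p = 0) :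
    ∫ p, g p ∂(hornMeasure f) = ∫ p, g p :=
  setIntegral_eq_integral_of_forall_compl_eq_zero hg

/-- A square integrable function orthogonal to all test functions in the horn vanishes. -/
theorem eq_zero_of_integral_test_smul_eq_zero (hc : ContinuousOn f (Set.Ioi 1))
    (k : Lp ℂ 2 (hornMeasure f))
    (h : ∀ χ : ℝ × ℝ → ℝ, ContDiff ℝ ∞ χ → HasCompactSupport χ → tsupport χ ⊆ hornDomain f →
      ∫ p, χ p • k p ∂(hornMeasure f) = 0) : k = 0 := by
  have hU := isOpen_hornDomain hc
  have : IsLocallyFiniteMeasure (hornMeasure f) := by unfold hornMeasure; infer_instance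
  have hloc : LocallyIntegrableOn k (hornDomain f) :=
    locallyIntegrableOn_of_locallyIntegrable_restrict
      ((Lp.memLp k).locallyIntegrable one_le_two)
  have hae := hU.ae_eq_zero_of_integral_contDiff_smul_eq_zero hloc fun χ h1 h2 h3 => by
    rw [← h χ h1 h2 h3, setIntegral_hornMeasure_eq]
    intro p hp
    rw [image_eq_zero_of_notMem_tsupport fun hp' => hp (h3 hp'), zero_smul]
  rw [Lp.eq_zero_iff_ae_eq_zero]
  exact (ae_restrict_iff' hU.measurableSet).2 hae

theorem memLp_test {χ : ℝ × ℝ → ℝ} (h1 : Continuous χ) (h2 : HasCompactSupport χ) :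
    MemLp (fun p => (χ p : ℂ)) 2 (hornMeasure f) := by
  have : HasCompactSupport fun p => (χ p : ℂ) := h2.comp_left (g := Complex.ofReal) (by simp)
  exact ((Complex.continuous_ofReal.comp h1).memLp_of_hasCompactSupport this).restrict _

theorem integral_test_smul_eq_inner {χ : ℝ × ℝ → ℝ} (hχ : MemLp (fun p => (χ p : ℂ)) 2 (hornMeasure f))
    (k : Lp ℂ 2 (hornMeasure f)) :
    ∫ p, χ p • k p ∂(hornMeasure f) = inner ℂ (hχ.toLp _) k := by
  conv_rhs => rw [← Lp.toLp_coeFn k (Lp.memLp k)]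
  rw [inner_toLp_toLp]
  simp

/-- Directional derivatives are closable in `L²` of the horn. -/
theorem eq_zero_of_tendsto_fderiv (hc : ContinuousOn f (Set.Ioi 1)) (v : ℝ × ℝ)
    {φ : ℕ → ℝ × ℝ → ℂ} (hφ : ∀ n, ContDiff ℝ 1 (φ n)) (h2 : ∀ n, MemLp (φ n) 2 (hornMeasure f))
    (hv : ∀ n, MemLp (fun p => fderiv ℝ (φ n) p v) 2 (hornMeasure f))
    (hlim : Tendsto (fun n => (h2 n).toLp (φ n)) atTop (𝓝 0)) {k : Lp ℂ 2 (hornMeasure f)}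
    (hlim' : Tendsto (fun n => (hv n).toLp (fun p => fderiv ℝ (φ n) p v)) atTop (𝓝 k)) : k = 0 := by
  refine eq_zero_of_integral_test_smul_eq_zero hc k fun χ h3 h4 h5 => ?_
  have hχ := memLp_test (f := f) h3.continuous h4
  have hcd : Continuous fun p => fderiv ℝ χ p v :=
    (h3.continuous_fderiv (by simp)).clm_apply continuous_const
  have hsd : HasCompactSupport fun p => fderiv ℝ χ p v :=
    (h4.fderiv (𝕜 := ℝ)).comp_left (g := fun L : (ℝ × ℝ) →L[ℝ] ℝ => L v) (by simp)
  have hχ' := memLp_test (f := f) hcd hsd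
  rw [integral_test_smul_eq_inner hχ]
  -- Integration by parts over the plane: the test function is compactly supported inside the horn,
  -- so no boundary terms arise.
  have hparts : ∀ n, inner ℂ (hχ.toLp _) ((hv n).toLp (fun p => fderiv ℝ (φ n) p v)) =
      - inner ℂ (hχ'.toLp _) ((h2 n).toLp (φ n)) := by
    intro n
    have hdc : Continuous fun p => fderiv ℝ (φ n) p v :=
      ((hφ n).continuous_fderiv one_ne_zero).clm_apply continuous_const
    have hχ0 : ∀ p ∉ hornDomain f, χ p = 0 := fun p hp =>
      image_eq_zero_of_notMem_tsupport fun hp' => hp (h5 hp')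
    have hχ'0 : ∀ p ∉ hornDomain f, fderiv ℝ χ p v = 0 := fun p hp => by
      rw [image_eq_zero_of_notMem_tsupport
        (fun hp' => hp (h5 (tsupport_fderiv_subset ℝ hp')))]
      rfl
    rw [inner_toLp_toLp, inner_toLp_toLp, setIntegral_hornMeasure_eq fun p hp => by simp [hχ0 p hp],
      setIntegral_hornMeasure_eq fun p hp => by simp [hχ'0 p hp]]
    have h := integral_smul_fderiv_eq_neg_fderiv_smul_of_integrable (μ := (volume : Measure (ℝ × ℝ)))
      (f := χ) (g := φ n) (v := v)
      ((hcd.smul (hφ n).continuous).integrable_of_hasCompactSupport hsd.smul_right)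
      ((h3.continuous.smul hdc).integrable_of_hasCompactSupport h4.smul_right)
      ((h3.continuous.smul (hφ n).continuous).integrable_of_hasCompactSupport h4.smul_right)
      (fun p _ => (h3.differentiable (by simp)) p)
      (fun p _ => ((hφ n).differentiable one_ne_zero) p)
    simpa using h
  have e1 := (tendsto_const_nhds (x := hχ.toLp _)).inner (𝕜 := ℂ) hlim'
  have e2 := ((tendsto_const_nhds (x := hχ'.toLp _)).inner (𝕜 := ℂ) hlim).neg
  simp only [hparts] at e1
  rw [tendsto_nhds_unique e1 e2]
  simp

/-- `traceSq_eq_integral` combined with `2 |w| |wy| ≤ |w|² + |wy|²`; the factor `1 / f` appears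
because the slice integral carries the Jacobian `f`. -/
theorem traceSq_le (hpos : ∀ x > 1, 0 < f x) {u : ℝ × ℝ → ℂ} (hu : ContDiff ℝ 1 u) {x : ℝ}
    (hx : 1 < x) :
    traceSq f u x ≤ ((f x)⁻¹ + 1) * fiberIntegral f (fun p => ‖u p‖ ^ 2) x +
      fiberIntegral f (fun p => ‖partialY u p‖ ^ 2) x := by
  have hfx := hpos x hx
  have hc := hu.continuous
  have hcY := continuous_partialY hu
  have c0 : Continuous fun t : ℝ => ‖u (x, f x * t)‖ ^ 2 := by fun_prop
  have cY : Continuous fun t : ℝ => ‖partialY u (x, f x * t)‖ ^ 2 := by fun_prop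
  have c2 : Continuous fun t => (‖u (x, f x * t)‖ ^ 2 +
    t * (2 * (f x * inner ℝ (u (x, f x * t)) (partialY u (x, f x * t))))) := by fun_prop
  have i0 := c0.intervalIntegrable (μ := volume) (-1) 1
  have iY := cY.intervalIntegrable (μ := volume) (-1) 1
  rw [traceSq_eq_integral hu, fiberIntegral, fiberIntegral, smul_eq_mul, smul_eq_mul,
    ← intervalIntegral.integral_const_mul, ← intervalIntegral.integral_const_mul,
    ← intervalIntegral.integral_const_mul, ← intervalIntegral.integral_add
      ((i0.const_mul _).const_mul _) (iY.const_mul _)]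
  refine intervalIntegral.integral_mono_on (by norm_num) (c2.intervalIntegrable _ _)
    (((i0.const_mul _).const_mul _).add (iY.const_mul _)) fun t ht => ?_
  set w := u (x, f x * t)
  set wy := partialY u (x, f x * t)
  have e1 : |t * inner ℝ w wy| ≤ ‖w‖ * ‖wy‖ := by
    rw [abs_mul]
    exact (mul_le_of_le_one_left (abs_nonneg _) (abs_le.2 ht)).trans (abs_real_inner_le_norm _ _)
  have e2 : 2 * (t * inner ℝ w wy) ≤ ‖w‖ ^ 2 + ‖wy‖ ^ 2 := by
    nlinarith [le_abs_self (t * inner ℝ w wy), sq_nonneg (‖w‖ - ‖wy‖)]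
  have e3 := mul_le_mul_of_nonneg_left e2 hfx.le
  have e4 : ((f x)⁻¹ + 1) * (f x * ‖w‖ ^ 2) = ‖w‖ ^ 2 + f x * ‖w‖ ^ 2 := by
    field_simp
  rw [e4]
  linarith

theorem setIntegral_boundaryMeasure {G : Type*} [NormedAddCommGroup G] [NormedSpace ℝ G]
    (hσ : ContinuousOn σ (Set.Ioi 1)) (h0 : ∀ x > 1, 0 ≤ σ x)
    {S : Set ℝ} (hS : MeasurableSet S) (hS1 : S ⊆ Set.Ioi 1) (g : ℝ → G) :
    ∫ x in S, g x ∂(boundaryMeasure σ) = ∫ x in S, σ x • g x := by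
  rw [← integral_indicator hS, integral_boundaryMeasure hσ h0,
    ← Set.inter_eq_right.2 hS1, ← setIntegral_indicator hS]
  refine setIntegral_congr_fun measurableSet_Ioi fun x _ => ?_
  rw [Set.inter_eq_right.2 hS1]
  by_cases hx : x ∈ S
  · simp [hx]
  · simp [hx]

/-- The constant `1 / f` of `traceSq_le` is unbounded along the cusp but bounded on a compact
interval by its value at the minimum of `f`. A local bound suffices for closability. -/
theorem setIntegral_traceSq_le (hf : IsCuspProfile f) (hσ : IsRobinCoefficient f σ) {a b : ℝ}
    (ha : 1 < a) (hab : a ≤ b) : ∃ C : ℝ, ∀ u : ℝ × ℝ → ℂ, ContDiff ℝ 1 u →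
      MemLp u 2 (hornMeasure f) → MemLp (partialY u) 2 (hornMeasure f) →
      ∫ x in Set.Icc a b, σ x * traceSq f u x ≤
        C * ((∫ p, ‖u p‖ ^ 2 ∂(hornMeasure f)) + ∫ p, ‖partialY u p‖ ^ 2 ∂(hornMeasure f)) := by
  obtain ⟨Cσ, hCσ⟩ := hσ.bounded
  have hCσ0 : 0 ≤ Cσ := (abs_nonneg _).trans (hCσ 2 (by norm_num)).1
  have hsub : Set.Icc a b ⊆ Set.Ioi 1 := fun x hx => ha.trans_le hx.1
  obtain ⟨y, hy, hmin⟩ := isCompact_Icc.exists_isMinOn (Set.nonempty_Icc.2 hab)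
    (hf.continuousOn.mono hsub)
  have hfy := hf.pos y (hsub hy)
  have hA0 : (0 : ℝ) ≤ (f y)⁻¹ + 1 := by positivity
  refine ⟨Cσ * ((f y)⁻¹ + 1), fun u hu hu2 huY => ?_⟩
  have iN := integrableOn_fiberIntegral hf.continuousOn hf.pos hu2.norm.integrable_sq
  have iY := integrableOn_fiberIntegral hf.continuousOn hf.pos huY.norm.integrable_sq
  rw [integral_hornMeasure hf.continuousOn hf.pos hu2.norm.integrable_sq,
    integral_hornMeasure hf.continuousOn hf.pos huY.norm.integrable_sq, ← integral_add iN iY,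
    ← integral_const_mul]
  have hnonneg : ∀ x ∈ Set.Ioi (1 : ℝ), 0 ≤ Cσ * ((f y)⁻¹ + 1) *
      (fiberIntegral f (fun p => ‖u p‖ ^ 2) x + fiberIntegral f (fun p => ‖partialY u p‖ ^ 2) x) :=
    fun x hx => mul_nonneg (by positivity)
      (add_nonneg (fiberIntegral_nonneg hf.pos (fun _ => by positivity) hx)
        (fiberIntegral_nonneg hf.pos (fun _ => by positivity) hx))
  refine le_trans ?_ (setIntegral_mono_set ((iN.add iY).const_mul _)
    ((ae_restrict_iff' measurableSet_Ioi).2 (Eventually.of_forall hnonneg))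
    (LE.le.eventuallyLE hsub))
  have hint : IntegrableOn (fun x => σ x * traceSq f u x) (Set.Icc a b) := by
    refine ContinuousOn.integrableOn_Icc ((hσ.smooth.continuousOn.mono hsub).mul ?_)
    have hc := hu.continuous
    have hfc := hf.continuousOn.mono hsub
    exact ((hc.comp_continuousOn (continuousOn_id.prodMk hfc)).norm.pow 2).add
      ((hc.comp_continuousOn (continuousOn_id.prodMk hfc.neg)).norm.pow 2)
  have hint' : IntegrableOn (fun x => Cσ * ((f y)⁻¹ + 1) *
      (fiberIntegral f (fun p => ‖u p‖ ^ 2) x + fiberIntegral f (fun p => ‖partialY u p‖ ^ 2) x))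
      (Set.Ioi 1) := (iN.add iY).const_mul _
  refine setIntegral_mono_on hint (hint'.mono_set hsub) measurableSet_Icc fun x hx => ?_
  have hx1 : 1 < x := hsub hx
  have hN0 := fiberIntegral_nonneg hf.pos (g := fun p => ‖u p‖ ^ 2) (fun _ => by positivity) hx1
  have hY0 := fiberIntegral_nonneg hf.pos (g := fun p => ‖partialY u p‖ ^ 2)
    (fun _ => by positivity) hx1
  have h1 : (f x)⁻¹ ≤ (f y)⁻¹ := inv_anti₀ hfy (hmin hx)
  have h2 : σ x ≤ Cσ := (le_abs_self _).trans (hCσ x hx1).1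
  rw [mul_assoc]
  refine mul_le_mul h2 ((traceSq_le hf.pos hu hx1).trans ?_) (traceSq_nonneg _ _ _) hCσ0
  rw [mul_add]
  refine add_le_add (by gcongr) (le_mul_of_one_le_left hY0 ?_)
  have : 0 ≤ (f y)⁻¹ := by positivity
  linarith

/-- The intervals `[1 + 1/(n+1), n + 2]` exhaust `(1, ∞)`, which carries the whole measure. -/
theorem ae_boundaryMeasure_of_forall_Icc {P : ℝ → Prop}
    (h : ∀ a b : ℝ, 1 < a → a ≤ b → ∀ᵐ x ∂((boundaryMeasure σ).restrict (Set.Icc a b)), P x) :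
    ∀ᵐ x ∂(boundaryMeasure σ), P x := by
  have h1 : ∀ᵐ x ∂(boundaryMeasure σ), x ∈ Set.Ioi (1 : ℝ) :=
    (withDensity_absolutelyContinuous _ _).ae_le (ae_restrict_mem measurableSet_Ioi)
  have h2 : ∀ᵐ x ∂(boundaryMeasure σ), ∀ n : ℕ,
      x ∈ Set.Icc (1 + 1 / ((n : ℝ) + 1)) (n + 2) → P x := by
    refine ae_all_iff.2 fun n => (ae_restrict_iff' measurableSet_Icc).1 (h _ _ ?_ ?_)
    · have : (0 : ℝ) < 1 / ((n : ℝ) + 1) := by positivity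
      linarith
    · have : 1 / ((n : ℝ) + 1) ≤ 1 := by
        rw [div_le_one (by positivity)]
        linarith [(Nat.cast_nonneg n : (0 : ℝ) ≤ n)]
      linarith [(Nat.cast_nonneg n : (0 : ℝ) ≤ n)]
  filter_upwards [h1, h2] with x hx1 hx2
  obtain ⟨n, hn⟩ := exists_nat_gt (max x (1 / (x - 1)))
  have hx : 0 < x - 1 := sub_pos.2 hx1
  have hn1 := (le_max_left _ _).trans_lt hn
  have hn2 := (le_max_right _ _).trans_lt hn
  refine hx2 n ⟨?_, by linarith⟩
  rw [div_lt_iff₀ hx] at hn2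
  have : 1 / ((n : ℝ) + 1) ≤ x - 1 := by
    rw [div_le_iff₀ (by positivity)]
    nlinarith
  linarith

/-- The boundary traces are closable along sequences bounded by the transversal derivative. -/
theorem eq_zero_of_tendsto_trace (hf : IsCuspProfile f) (hσ : IsRobinCoefficient f σ)
    {φ : ℕ → ℝ × ℝ → ℂ} (hφ : ∀ n, ContDiff ℝ 1 (φ n)) (h2 : ∀ n, MemLp (φ n) 2 (hornMeasure f))
    (hY : ∀ n, MemLp (partialY (φ n)) 2 (hornMeasure f))
    (hlim : Tendsto (fun n => (h2 n).toLp (φ n)) atTop (𝓝 0))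
    (hlimY : Tendsto (fun n => (hY n).toLp (partialY (φ n))) atTop (𝓝 0))
    {τ : ℕ → ℝ → ℂ} (hτ : ∀ n, MemLp (τ n) 2 (boundaryMeasure σ))
    (hτle : ∀ n x, ‖τ n x‖ ^ 2 ≤ traceSq f (φ n) x) {k : Lp ℂ 2 (boundaryMeasure σ)}
    (hk : Tendsto (fun n => (hτ n).toLp (τ n)) atTop (𝓝 k)) : k = 0 := by
  rw [Lp.eq_zero_iff_ae_eq_zero]
  refine ae_boundaryMeasure_of_forall_Icc fun a b ha hab => ?_
  have hsub : Set.Icc a b ⊆ Set.Ioi 1 := fun x hx => ha.trans_le hx.1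
  let L := LpToLpRestrictCLM ℝ ℂ ℂ (boundaryMeasure σ) 2 (Set.Icc a b)
  have hL : ∀ n, ‖L ((hτ n).toLp (τ n))‖ ^ 2 = ∫ x in Set.Icc a b, σ x * ‖τ n x‖ ^ 2 := by
    intro n
    have e : L ((hτ n).toLp (τ n)) = ((hτ n).restrict _).toLp (τ n) := by
      apply Lp.ext
      filter_upwards [LpToLpRestrictCLM_coeFn ℂ (Set.Icc a b) ((hτ n).toLp (τ n)),
        ((hτ n).restrict (Set.Icc a b)).coeFn_toLp, ae_restrict_of_ae (hτ n).coeFn_toLp]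
        with x h1 h2 h3
      rw [h2, ← h3, ← h1]
    rw [e, norm_toLp_sq, setIntegral_boundaryMeasure hσ.smooth.continuousOn hσ.nonneg
      measurableSet_Icc hsub]
    rfl
  obtain ⟨C, hC⟩ := setIntegral_traceSq_le hf hσ ha hab
  have hbound : ∀ n, ‖L ((hτ n).toLp (τ n))‖ ^ 2 ≤
      C * (‖(h2 n).toLp (φ n)‖ ^ 2 + ‖(hY n).toLp (partialY (φ n))‖ ^ 2) := by
    intro n
    rw [hL, norm_toLp_sq, norm_toLp_sq]
    refine le_trans ?_ (hC (φ n) (hφ n) (h2 n) (hY n))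
    have hint : IntegrableOn (fun x => σ x * traceSq f (φ n) x) (Set.Icc a b) := by
      refine ContinuousOn.integrableOn_Icc ((hσ.smooth.continuousOn.mono hsub).mul ?_)
      have hc := (hφ n).continuous
      have hfc := hf.continuousOn.mono hsub
      exact ((hc.comp_continuousOn (continuousOn_id.prodMk hfc)).norm.pow 2).add
        ((hc.comp_continuousOn (continuousOn_id.prodMk hfc.neg)).norm.pow 2)
    refine setIntegral_mono_on (((integrable_boundaryMeasure_iff hσ.smooth.continuousOn
      hσ.nonneg).1 (hτ n).norm.integrable_sq).mono_set hsub) hint measurableSet_Icc fun x hx => ?_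
    exact mul_le_mul_of_nonneg_left (hτle n x) (hσ.nonneg x (hsub hx))
  have hlim1 : Tendsto (fun n => ‖L ((hτ n).toLp (τ n))‖ ^ 2) atTop (𝓝 (‖L k‖ ^ 2)) :=
    ((L.continuous.tendsto k).comp hk).norm.pow 2
  have hlim2 := ((hlim.norm.pow 2).add (hlimY.norm.pow 2)).const_mul C
  -- The trace limit, restricted to `[a, b]`, is bounded by the limits of `φ n` and `∂φ n/∂y`, both
  -- zero.
  have hle := le_of_tendsto_of_tendsto' hlim1 hlim2 hbound
  have hLk : L k = 0 := by
    rw [← norm_eq_zero, ← sq_eq_zero_iff]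
    refine le_antisymm (hle.trans (by simp)) (sq_nonneg _)
  have h3 := LpToLpRestrictCLM_coeFn ℂ (Set.Icc a b) k
  have h4 : (L k : ℝ → ℂ) =ᵐ[(boundaryMeasure σ).restrict (Set.Icc a b)] 0 := by
    rw [hLk]
    exact Lp.coeFn_zero _ _ _
  filter_upwards [h3, h4] with x h5 h6
  rw [← h5]
  exact h6

end Closability

/-! ### The Robin form in the abstract scheme -/

section RobinForm

variable {f σ : ℝ → ℝ}

theorem robinCore_contDiff (u : robinCore f σ) : ContDiff ℝ 2 (u : ℝ × ℝ → ℂ) := u.2.1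

theorem robinCore_contDiff_one (u : robinCore f σ) : ContDiff ℝ 1 (u : ℝ × ℝ → ℂ) :=
  (robinCore_contDiff u).of_le (by norm_num)

theorem robinCore_memLp (u : robinCore f σ) : MemLp (u : ℝ × ℝ → ℂ) 2 (hornMeasure f) := u.2.2.2.1

theorem robinCore_memLp_partialX (u : robinCore f σ) : MemLp (partialX u) 2 (hornMeasure f) :=
  u.2.2.2.2.1

theorem robinCore_memLp_partialY (u : robinCore f σ) : MemLp (partialY u) 2 (hornMeasure f) :=
  u.2.2.2.2.2.1

theorem robinCore_memLp_upper (u : robinCore f σ) :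
    MemLp (fun x => (u : ℝ × ℝ → ℂ) (x, f x)) 2 (boundaryMeasure σ) :=
  u.2.2.2.2.2.2.1

theorem robinCore_memLp_lower (u : robinCore f σ) :
    MemLp (fun x => (u : ℝ × ℝ → ℂ) (x, -f x)) 2 (boundaryMeasure σ) :=
  u.2.2.2.2.2.2.2

/-- The derivative `∂u/∂x` as an element of `L²`. -/
noncomputable def robinPartialX (f σ : ℝ → ℝ) : robinCore f σ →ₗ[ℂ] Lp ℂ 2 (hornMeasure f) where
  toFun u := (robinCore_memLp_partialX u).toLp _
  map_add' u v := by
    rw [← MemLp.toLp_add]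
    congr 1
    ext p
    simp [partialX, fderiv_add ((robinCore_contDiff_one u).differentiable one_ne_zero p)
      ((robinCore_contDiff_one v).differentiable one_ne_zero p)]
  map_smul' c u := by
    rw [RingHom.id_apply, ← MemLp.toLp_const_smul]
    congr 1
    ext p
    simp [partialX, fderiv_const_smul ((robinCore_contDiff_one u).differentiable one_ne_zero p)]

/-- The derivative `∂u/∂y` as an element of `L²`. -/
noncomputable def robinPartialY (f σ : ℝ → ℝ) : robinCore f σ →ₗ[ℂ] Lp ℂ 2 (hornMeasure f) where
  toFun u := (robinCore_memLp_partialY u).toLp _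
  map_add' u v := by
    rw [← MemLp.toLp_add]
    congr 1
    ext p
    simp [partialY, fderiv_add ((robinCore_contDiff_one u).differentiable one_ne_zero p)
      ((robinCore_contDiff_one v).differentiable one_ne_zero p)]
  map_smul' c u := by
    rw [RingHom.id_apply, ← MemLp.toLp_const_smul]
    congr 1
    ext p
    simp [partialY, fderiv_const_smul ((robinCore_contDiff_one u).differentiable one_ne_zero p)]

/-- The trace on the upper boundary as an element of `L²`. -/
noncomputable def robinUpper (f σ : ℝ → ℝ) : robinCore f σ →ₗ[ℂ] Lp ℂ 2 (boundaryMeasure σ) where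
  toFun u := (robinCore_memLp_upper u).toLp _
  map_add' _ _ := rfl
  map_smul' _ _ := rfl

/-- The trace on the lower boundary as an element of `L²`. -/
noncomputable def robinLower (f σ : ℝ → ℝ) : robinCore f σ →ₗ[ℂ] Lp ℂ 2 (boundaryMeasure σ) where
  toFun u := (robinCore_memLp_lower u).toLp _
  map_add' _ _ := rfl
  map_smul' _ _ := rfl

/-- The gradient together with the boundary traces. -/
noncomputable def robinMap (f σ : ℝ → ℝ) : robinCore f σ →ₗ[ℂ]
    WithLp 2 (WithLp 2 (Lp ℂ 2 (hornMeasure f) × Lp ℂ 2 (hornMeasure f)) ×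
      WithLp 2 (Lp ℂ 2 (boundaryMeasure σ) × Lp ℂ 2 (boundaryMeasure σ))) :=
  (WithLp.linearEquiv 2 ℂ _).symm.toLinearMap ∘ₗ
    ((WithLp.linearEquiv 2 ℂ _).symm.toLinearMap ∘ₗ (robinPartialX f σ).prod (robinPartialY f σ)).prod
    ((WithLp.linearEquiv 2 ℂ _).symm.toLinearMap ∘ₗ (robinUpper f σ).prod (robinLower f σ))

theorem robinNonnegForm_q_eq_inner (u v : robinCore f σ) :
    (robinNonnegForm f σ).q u v = inner ℂ (robinMap f σ u) (robinMap f σ v) := by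
  rw [WithLp.prod_inner_apply, WithLp.prod_inner_apply, WithLp.prod_inner_apply]
  change robinForm f σ u v =
    inner ℂ ((robinCore_memLp_partialX u).toLp _) ((robinCore_memLp_partialX v).toLp _) +
    inner ℂ ((robinCore_memLp_partialY u).toLp _) ((robinCore_memLp_partialY v).toLp _) +
    (inner ℂ ((robinCore_memLp_upper u).toLp _) ((robinCore_memLp_upper v).toLp _) +
    inner ℂ ((robinCore_memLp_lower u).toLp _) ((robinCore_memLp_lower v).toLp _))
  simp only [inner_toLp_toLp]
  rw [robinForm, integral_add, integral_add]
  · exact integrable_conj_mul (robinCore_memLp_upper u) (robinCore_memLp_upper v)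
  · exact integrable_conj_mul (robinCore_memLp_lower u) (robinCore_memLp_lower v)
  · exact integrable_conj_mul (robinCore_memLp_partialX u) (robinCore_memLp_partialX v)
  · exact integrable_conj_mul (robinCore_memLp_partialY u) (robinCore_memLp_partialY v)

theorem norm_robinMap_sq (u : robinCore f σ) :
    ‖robinMap f σ u‖ ^ 2 =
      (∫ p, (‖partialX u p‖ ^ 2 + ‖partialY u p‖ ^ 2) ∂(hornMeasure f)) +
        ∫ x, traceSq f u x ∂(boundaryMeasure σ) := by
  rw [WithLp.prod_norm_sq_eq_of_L2, WithLp.prod_norm_sq_eq_of_L2, WithLp.prod_norm_sq_eq_of_L2]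
  change ‖(robinCore_memLp_partialX u).toLp _‖ ^ 2 + ‖(robinCore_memLp_partialY u).toLp _‖ ^ 2 +
    (‖(robinCore_memLp_upper u).toLp _‖ ^ 2 + ‖(robinCore_memLp_lower u).toLp _‖ ^ 2) = _
  simp only [norm_toLp_sq, traceSq]
  rw [integral_add, integral_add]
  · exact (robinCore_memLp_upper u).norm.integrable_sq
  · exact (robinCore_memLp_lower u).norm.integrable_sq
  · exact (robinCore_memLp_partialX u).norm.integrable_sq
  · exact (robinCore_memLp_partialY u).norm.integrable_sq

/-- The derivatives come first: the vanishing of the limit of `∂u/∂y` is an input for the vanishing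
of the trace limits. -/
theorem robinMap_closable (hf : IsCuspProfile f) (hσ : IsRobinCoefficient f σ)
    (φ : ℕ → robinCore f σ) (k)
    (h : Tendsto (fun n => (robinNonnegForm f σ).emb (φ n)) atTop (𝓝 0))
    (hk : Tendsto (fun n => robinMap f σ (φ n)) atTop (𝓝 k)) : k = 0 := by
  have hfst := ((WithLp.fstL 2 ℂ _ _).continuous.tendsto k).comp hk
  have hsnd := ((WithLp.sndL 2 ℂ _ _).continuous.tendsto k).comp hk
  have hX := ((WithLp.fstL 2 ℂ _ _).continuous.tendsto _).comp hfst
  have hY := ((WithLp.sndL 2 ℂ _ _).continuous.tendsto _).comp hfst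
  have hU := ((WithLp.fstL 2 ℂ _ _).continuous.tendsto _).comp hsnd
  have hL := ((WithLp.sndL 2 ℂ _ _).continuous.tendsto _).comp hsnd
  have kX := eq_zero_of_tendsto_fderiv hf.continuousOn (1, 0)
    (fun n => robinCore_contDiff_one (φ n)) (fun n => robinCore_memLp (φ n))
    (fun n => robinCore_memLp_partialX (φ n)) h hX
  have kY := eq_zero_of_tendsto_fderiv hf.continuousOn (0, 1)
    (fun n => robinCore_contDiff_one (φ n)) (fun n => robinCore_memLp (φ n))
    (fun n => robinCore_memLp_partialY (φ n)) h hY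
  rw [kY] at hY
  have kU := eq_zero_of_tendsto_trace hf hσ
    (fun n => robinCore_contDiff_one (φ n)) (fun n => robinCore_memLp (φ n))
    (fun n => robinCore_memLp_partialY (φ n)) h hY (fun n => robinCore_memLp_upper (φ n))
    (fun n x => le_add_of_nonneg_right (by positivity)) hU
  have kL := eq_zero_of_tendsto_trace hf hσ
    (fun n => robinCore_contDiff_one (φ n)) (fun n => robinCore_memLp (φ n))
    (fun n => robinCore_memLp_partialY (φ n)) h hY (fun n => robinCore_memLp_lower (φ n))
    (fun n x => le_add_of_nonneg_left (by positivity)) hL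
  rw [← norm_eq_zero, ← sq_eq_zero_iff, WithLp.prod_norm_sq_eq_of_L2, WithLp.prod_norm_sq_eq_of_L2,
    WithLp.prod_norm_sq_eq_of_L2]
  change ‖WithLp.fstL 2 ℂ _ _ (WithLp.fstL 2 ℂ _ _ k)‖ ^ 2 +
    ‖WithLp.sndL 2 ℂ _ _ (WithLp.fstL 2 ℂ _ _ k)‖ ^ 2 +
    (‖WithLp.fstL 2 ℂ _ _ (WithLp.sndL 2 ℂ _ _ k)‖ ^ 2 +
    ‖WithLp.sndL 2 ℂ _ _ (WithLp.sndL 2 ℂ _ _ k)‖ ^ 2) = 0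
  rw [kX, kY, kU, kL]
  simp

theorem test_mem_robinCore {χ : ℝ × ℝ → ℝ} (h1 : ContDiff ℝ ∞ χ) (h2 : HasCompactSupport χ)
    (h3 : tsupport χ ⊆ hornDomain f) : (fun p => (χ p : ℂ)) ∈ robinCore f σ := by
  have hc : ContDiff ℝ 2 fun p => (χ p : ℂ) :=
    Complex.ofRealCLM.contDiff.comp (contDiff_infty.1 h1 2)
  have hs : HasCompactSupport fun p => (χ p : ℂ) := h2.comp_left (g := Complex.ofReal) (by simp)
  have hv : ∀ v : ℝ × ℝ, MemLp (fun p => fderiv ℝ (fun p => (χ p : ℂ)) p v) 2 (hornMeasure f) := by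
    intro v
    have hcd : Continuous fun p => fderiv ℝ (fun p => (χ p : ℂ)) p v :=
      (hc.continuous_fderiv two_ne_zero).clm_apply continuous_const
    exact (hcd.memLp_of_hasCompactSupport ((hs.fderiv (𝕜 := ℝ)).comp_left
      (g := fun L : (ℝ × ℝ) →L[ℝ] ℂ => L v) (by simp))).restrict _
  have hz : ∀ p ∉ hornDomain f, (χ p : ℂ) = 0 := fun p hp => by
    rw [image_eq_zero_of_notMem_tsupport fun hp' => hp (h3 hp'), Complex.ofReal_zero]
  have hb : ∀ s : ℝ, |s| = 1 → MemLp (fun x => (χ (x, s * f x) : ℂ)) 2 (boundaryMeasure σ) := by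
    intro s hs1
    have : (fun x => (χ (x, s * f x) : ℂ)) = fun _ => 0 := by
      ext x
      refine hz _ fun hx => ?_
      -- Boundary points are not in the horn, so test functions have zero trace; this holds for
      -- every real `x`, whatever the sign of `f x`.
      have h4 : |s * f x| < f x := hx.2
      rw [abs_mul, hs1, one_mul] at h4
      exact absurd (le_abs_self (f x)) (not_le.2 h4)
    rw [this]
    exact MemLp.zero
  have hslice : ∀ y : ℝ, tsupport (fun x => (χ (x, y) : ℂ)) ⊆ (fun x => (x, y)) ⁻¹' tsupport χ := by
    intro y
    refine closure_minimal (fun x hx => subset_tsupport _ ?_)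
      ((isClosed_tsupport χ).preimage (by fun_prop))
    simpa using hx
  refine ⟨hc, fun y => ⟨?_, fun x hx => (h3 (hslice y hx)).1⟩, memLp_test h1.continuous h2,
    hv _, hv _, by simpa using hb 1 (by simp), by simpa using hb (-1) (by simp)⟩
  refine HasCompactSupport.intro (K := Prod.fst '' tsupport χ) (h2.isCompact.image continuous_fst)
    fun x hx => ?_
  change (χ (x, y) : ℂ) = 0
  rw [image_eq_zero_of_notMem_tsupport fun hp => hx ⟨(x, y), hp, rfl⟩, Complex.ofReal_zero]

theorem denseRange_robin_emb (hc : ContinuousOn f (Set.Ioi 1)) :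
    DenseRange (robinNonnegForm f σ).emb := by
  have h : Dense (LinearMap.range (robinNonnegForm f σ).emb : Set (Lp ℂ 2 (hornMeasure f))) := by
    rw [Submodule.dense_iff_topologicalClosure_eq_top, Submodule.topologicalClosure_eq_top_iff,
      Submodule.eq_bot_iff]
    intro k hk
    refine eq_zero_of_integral_test_smul_eq_zero hc k fun χ h1 h2 h3 => ?_
    rw [integral_test_smul_eq_inner (memLp_test h1.continuous h2)]
    exact (Submodule.mem_orthogonal _ _).1 hk _
      ⟨⟨fun p => (χ p : ℂ), test_mem_robinCore h1 h2 h3⟩, rfl⟩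
  exact h

/-- Body and tail each contribute half of `ε`; only the body produces functionals. -/
theorem robin_emb_compact (hf : IsCuspProfile f) (hreg : IsRegularAtOne f)
    (hσ : IsRobinCoefficient f σ) {ε : ℝ} (hε : 0 < ε) :
    ∃ (ι : Type) (s : Finset ι) (g : ι → Lp ℂ 2 (hornMeasure f)) (C : ℝ), ∀ u,
      ‖(robinNonnegForm f σ).emb u‖ ^ 2 ≤
        ε * (‖(robinNonnegForm f σ).emb u‖ ^ 2 + ‖robinMap f σ u‖ ^ 2) +
        C * ∑ i ∈ s, ‖inner ℂ (g i) ((robinNonnegForm f σ).emb u)‖ ^ 2 := by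
  obtain ⟨K, hK, htail⟩ := exists_integral_tail_le hf hσ
  -- The tail is at most `(T + K E) / M ≤ (1 + K) (E + T) / M`, which is `ε / 2 * (E + T)` for this
  -- `M`, with `E` and `T` the squared norms of `u` and `robinMap f σ u`.
  set M := 2 * (1 + K) / ε with hM
  have hM0 : 0 < M := by positivity
  obtain ⟨R, hR, htail⟩ := htail M hM0.le
  obtain ⟨s, g, C, hbody⟩ := exists_integral_body_le hf hreg hR (half_pos hε)
  refine ⟨ℕ × ℕ, s, g, C, fun u => ?_⟩
  have hu := robinCore_contDiff_one u
  have hu2 := robinCore_memLp u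
  have huX := robinCore_memLp_partialX u
  have huY := robinCore_memLp_partialY u
  have iD' : Integrable (fun p => ‖partialX (u : ℝ × ℝ → ℂ) p‖ ^ 2 +
      ‖partialY (u : ℝ × ℝ → ℂ) p‖ ^ 2) (hornMeasure f) := huX.norm.integrable_sq.add huY.norm.integrable_sq
  have iB' : Integrable (traceSq f (u : ℝ × ℝ → ℂ)) (boundaryMeasure σ) :=
    (robinCore_memLp_upper u).norm.integrable_sq.add (robinCore_memLp_lower u).norm.integrable_sq
  have iN := integrableOn_fiberIntegral hf.continuousOn hf.pos hu2.norm.integrable_sq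
  have iD := integrableOn_fiberIntegral hf.continuousOn hf.pos iD'
  have iB := (integrable_boundaryMeasure_iff hσ.smooth.continuousOn hσ.nonneg).1 iB'
  have h1 := htail u hu iN iD iB
  have h2 := hbody u hu hu2 huX huY
  have hemb : ‖(robinNonnegForm f σ).emb u‖ ^ 2 =
      ∫ x in Set.Ioi 1, fiberIntegral f (fun p => ‖(u : ℝ × ℝ → ℂ) p‖ ^ 2) x := by
    rw [← integral_hornMeasure hf.continuousOn hf.pos hu2.norm.integrable_sq, ← norm_toLp_sq hu2]
    rfl
  have hmap : ‖robinMap f σ u‖ ^ 2 = (∫ x in Set.Ioi 1, fiberIntegral f (fun p =>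
      ‖partialX (u : ℝ × ℝ → ℂ) p‖ ^ 2 + ‖partialY (u : ℝ × ℝ → ℂ) p‖ ^ 2) x) +
      ∫ x in Set.Ioi 1, σ x * traceSq f u x := by
    rw [norm_robinMap_sq, integral_boundaryMeasure hσ.smooth.continuousOn hσ.nonneg]
    congr 1
    exact integral_hornMeasure hf.continuousOn hf.pos iD'
  have hsplit : ∫ x in Set.Ioi 1, fiberIntegral f (fun p => ‖(u : ℝ × ℝ → ℂ) p‖ ^ 2) x =
      (∫ x in (1 : ℝ)..R, fiberIntegral f (fun p => ‖(u : ℝ × ℝ → ℂ) p‖ ^ 2) x) +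
      ∫ x in Set.Ioi R, fiberIntegral f (fun p => ‖(u : ℝ × ℝ → ℂ) p‖ ^ 2) x := by
    rw [intervalIntegral.integral_of_le hR.le, ← setIntegral_union
      (Set.Ioc_disjoint_Ioi le_rfl) measurableSet_Ioi (iN.mono_set Set.Ioc_subset_Ioi_self)
      (iN.mono_set (Set.Ioi_subset_Ioi hR.le)), Set.Ioc_union_Ioi_eq_Ioi hR.le]
  have hB0 : 0 ≤ ∫ x in Set.Ioi 1, σ x * traceSq f u x :=
    setIntegral_nonneg measurableSet_Ioi fun x hx =>
      mul_nonneg (hσ.nonneg x hx) (traceSq_nonneg _ _ _)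
  have hD := intervalIntegral_le_setIntegral_Ioi iD (fun x hx =>
    fiberIntegral_nonneg hf.pos (fun _ => by positivity) hx) le_rfl hR.le
  rw [← hemb] at h1
  set E := ‖(robinNonnegForm f σ).emb u‖ ^ 2 with hE
  set T := ‖robinMap f σ u‖ ^ 2 with hT
  have hE0 : 0 ≤ E := sq_nonneg _
  have hT0 : 0 ≤ T := sq_nonneg _
  have h3 : ∫ x in Set.Ioi R, fiberIntegral f (fun p => ‖(u : ℝ × ℝ → ℂ) p‖ ^ 2) x ≤
      ε / 2 * (E + T) := by
    refine le_of_mul_le_mul_left (h1.trans ?_) hM0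
    have e : M * (ε / 2 * (E + T)) = (1 + K) * (E + T) := by rw [hM]; field_simp
    rw [e, ← hmap]
    nlinarith [mul_nonneg hK hT0]
  have h4 : (∫ x in (1 : ℝ)..R, fiberIntegral f (fun p =>
      ‖partialX (u : ℝ × ℝ → ℂ) p‖ ^ 2 + ‖partialY (u : ℝ × ℝ → ℂ) p‖ ^ 2) x) ≤ E + T :=
    hD.trans (by linarith)
  have h5 := mul_le_mul_of_nonneg_left h4 (half_pos hε).le
  have h6 : E ≤ ε * (E + T) + C * ∑ i ∈ s, ‖inner ℂ (g i) (hu2.toLp u)‖ ^ 2 := by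
    linarith [hemb.trans hsplit]
  exact h6

end RobinForm

theorem theorem1 (f σ : ℝ → ℝ) (hf : IsCuspProfile f) (hreg : IsRegularAtOne f)
    (hσ : IsRobinCoefficient f σ) :
    (robinNonnegForm f σ).IsClosable ∧
    IsSelfAdjoint (robinLaplacian f σ) ∧
    HasPurelyDiscreteSpectrum (robinLaplacian f σ) := by
  exact NonnegForm.isSelfAdjoint_and_hasPurelyDiscreteSpectrum robinNonnegForm_q_eq_inner
    (robinMap_closable hf hσ) (denseRange_robin_emb hf.continuousOn)
    fun _ hε => robin_emb_compact hf hreg hσ hε
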